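/- **Notation.** Let $\mathbb T=[-1/2,1/2)$ with Lebesgue measure and $T_yf(x)=f(x-y)$. For $f\in L^2(\mathbb R^k)$ with ($L^2$-)Fourier transform $\hat f$ (kernel $e^{-2\pi i\langle y,x\rangle}$) let $\Gamma f(x)=(\hat f(x+\ell))_{\ell\in\mathbb Z^k}\in\ell^2(\mathbb Z^k)$ for a.e. $x\in\mathbb T^k$. A subspace $\mathcal W\subseteq L^2(\mathbb R^k)$ is FSI (finitely generated shift-invariant) if $\mathcal W=\overline{\operatorname{span}}\{T_\ell f: f\in\mathcal A,\ \ell\in\mathbb Z^k\}$ for some finite $\mathcal A\subset L^2(\mathbb R^k)$. Its range function $J_{\mathcal W}$ is the (a.e. unique) function from $\mathbb T^k$ to the closed subspaces of $\ell^2(\mathbb Z^k)$ such that $x\mapsto\langle P_{J_{\mathcal W}(x)}\xi,\eta\rangle$ is measurable for all $\xi,\eta\in\ell^2(\mathbb Z^k)$ and $\mathcal W=\{f\in L^2(\mathbb R^k):\Gamma f(x)\in J_{\mathcal W}(x)\text{ for a.e. }x\in\mathbb T^k\}$; put $d(x)=\dim J_{\mathcal W}(x)$, which is finite for a.e. $x$.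 For $\mathcal F=(f_j)_{j\le n}$ let $E(\mathcal F)=\{T_\ell f_j\}_{\ell\in\mathbb Z^k,\,j\le n}$. It is a Bessel sequence if for some $b>0$, $\sum_{\ell,j}|\langle g,T_\ell f_j\rangle|^2\le b\|g\|^2$ for all $g\in L^2(\mathbb R^k)$; then its frame operator is $S_{E(\mathcal F)}g=\sum_{\ell,j}\langle g,T_\ell f_j\rangle\,T_\ell f_j$. For a bounded operator $S$ on $L^2(\mathbb R^k)$ commuting with all $T_\ell$, $\ell\in\mathbb Z^k$, let $x\mapsto[S]_x$ be the (a.e. unique) weakly measurable, essentially bounded field of operators on $\ell^2(\mathbb Z^k)$ with $[S]_x\Gamma f(x)=\Gamma(Sf)(x)$ for a.e. $x$, for each $f\in L^2(\mathbb R^k)$. For a positive finite rank operator $A$, $(\lambda_j(A))_{j\ge1}$ denotes its eigenvalues in non-increasing order, counting multiplicities, completed with zeros. For $a\in\mathbb R^n$, $b\in\mathbb R^m$ with non-increasing rearrangements $a^\downarrow,b^\downarrow$, write $a\prec b$ if $\sum_{i\le r}a_i^\downarrow\le\sum_{i\le r}b_i^\downarrow$ for $1\le r\le\min\{n,m\}$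 and $\sum_{i\le n}a_i=\sum_{i\le m}b_i$ (empty sums being $0$). **Theorem 3.3.** Let $\mathcal W$ be an FSI subspace of $L^2(\mathbb R^k)$ with fiber dimensions $d(x)=\dim J_{\mathcal W}(x)$, and let $\alpha_j:\mathbb T^k\to[0,\infty)$ ($1\le j\le n$) and $\lambda_j:\mathbb T^k\to[0,\infty)$ ($j\in\mathbb N$) be measurable functions. The following are equivalent. 1. There is $\mathcal F=(f_j)_{j\le n}\in\mathcal W^n$ such that $E(\mathcal F)$ is a Bessel sequence and, for a.e. $x\in\mathbb T^k$, $\|\Gamma f_j(x)\|^2=\alpha_j(x)$ for $1\le j\le n$ and $\lambda_j([S_{E(\mathcal F)}]_x)=\lambda_j(x)$ for all $j\in\mathbb N$. 2. The functions $\lambda_j$ are essentially bounded by a common constant, $\lambda_1(x)\ge\lambda_2(x)\ge\cdots$ for a.e. $x$, and, for a.e. $x\in\mathbb T^k$: (a) $\lambda_j(x)=0$ for all $j\ge\min\{d(x),n\}+1$; (b) $(\alpha_j(x))_{1\le j\le n}\prec(\lambda_j(x))_{1\le j\le d(x)}$. In particular, (1) implies (a) and (b) for arbitrary measurable $\alpha_j,\lambda_j\ge0$,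 and for essentially bounded, non-increasingly ordered $(\lambda_j)_{j}$ condition (1) is equivalent to (a) and (b). -/

import Mathlib

open MeasureTheory
open scoped NNReal FourierTransform InnerProductSpace

noncomputable section

namespace ShiftGenerated

/-! ### Bessel sequences and frame operators in a Hilbert space -/

section Hilbert

variable {ι H : Type*} [NormedAddCommGroup H] [InnerProductSpace ℂ H]

/-- `f` is a Bessel sequence: `∑ i, |⟨g, f i⟩| ^ 2 ≤ b * ‖g‖ ^ 2` for all `g`, for some `b > 0`. -/
def IsBessel (f : ι → H) : Prop :=
  ∃ b : ℝ, 0 < b ∧ ∀ g : H,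
    Summable (fun i => ‖⟪f i, g⟫_ℂ‖ ^ 2) ∧ ∑' i, ‖⟪f i, g⟫_ℂ‖ ^ 2 ≤ b * ‖g‖ ^ 2

theorem IsBessel.memℓp {f : ι → H} (hf : IsBessel f) (g : H) :
    Memℓp (fun i => ⟪f i, g⟫_ℂ) 2 := by
  obtain ⟨b, -, h⟩ := hf
  refine memℓp_gen ?_
  simpa using (h g).1

/-- The analysis operator `g ↦ (⟨g, f i⟩)_i` (Mathlib's inner product is linear in its second
variable). -/
def analysisOperator (f : ι → H) (hf : IsBessel f) : H →L[ℂ] lp (fun _ : ι => ℂ) 2 :=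
  LinearMap.mkContinuousOfExistsBound
    { toFun := fun g => ⟨fun i => ⟪f i, g⟫_ℂ, hf.memℓp g⟩
      map_add' := fun g h => by ext i; exact inner_add_right _ _ _
      map_smul' := fun c g => by ext i; exact inner_smul_right _ _ _ }
    (by
      obtain ⟨b, hb, h⟩ := id hf
      refine ⟨Real.sqrt b, fun g => ?_⟩
      refine abs_le_of_sq_le_sq' ?_ (by positivity) |>.2
      rw [mul_pow, Real.sq_sqrt hb.le]
      refine le_trans (le_of_eq ?_) (h g).2
      have := lp.norm_rpow_eq_tsum (p := 2) (by norm_num)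
        (⟨fun i => ⟪f i, g⟫_ℂ, hf.memℓp g⟩ : lp (fun _ : ι => ℂ) 2)
      simpa using this)

@[simp] theorem analysisOperator_apply (f : ι → H) (hf : IsBessel f) (g : H) (i : ι) :
    (analysisOperator f hf g : ι → ℂ) i = ⟪f i, g⟫_ℂ := rfl

variable [CompleteSpace H]

/-- The synthesis operator, i.e. the adjoint of the analysis operator; it is
`(a_i)_i ↦ ∑ i, a_i • f i`, see `hasSum_synthesisOperator`. -/
def synthesisOperator (f : ι → H) (hf : IsBessel f) : lp (fun _ : ι => ℂ) 2 →L[ℂ] H :=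
  ContinuousLinearMap.adjoint (analysisOperator f hf)

/-- The frame operator `S = T T^*`, where `T` is the synthesis operator. -/
def frameOperator (f : ι → H) (hf : IsBessel f) : H →L[ℂ] H :=
  synthesisOperator f hf ∘L analysisOperator f hf

theorem hasSum_synthesisOperator (f : ι → H) (hf : IsBessel f) (a : lp (fun _ : ι => ℂ) 2) :
    HasSum (fun i => a i • f i) (synthesisOperator f hf a) := by
  classical
  have h1 := (lp.hasSum_single (p := 2) (by norm_num) a).mapL (synthesisOperator f hf)
  refine h1.congr_fun ?_
  intro i
  refine ext_inner_right ℂ fun g => ?_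
  rw [synthesisOperator, ContinuousLinearMap.adjoint_inner_left, lp.inner_single_left,
    analysisOperator_apply, inner_smul_left]
  simp [mul_comm]

end Hilbert

/-! ### Eigenvalues counted with multiplicity -/

/-- `μ` is the sequence of eigenvalues of the positive finite rank operator `A`, arranged in
non-increasing order, counting multiplicities, and completed with zeros: every `t > 0` occurs in
`μ` exactly `dim ker (A - t)` times. -/
def IsEigenvalueSequence {H : Type*} [NormedAddCommGroup H] [InnerProductSpace ℂ H]
    (A : H →L[ℂ] H) (μ : ℕ → ℝ≥0) : Prop :=
  Antitone μ ∧ ∀ t : ℝ≥0, 0 < t →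
    {j : ℕ | μ j = t}.encard =
      Cardinal.toENat (Module.rank ℂ (Module.End.eigenspace (A : H →ₗ[ℂ] H) ((t : ℝ) : ℂ)))

/-! ### Majorization of vectors of possibly different lengths -/

/-- The non-increasing rearrangement of a real vector. -/
def decreasing {n : ℕ} (a : Fin n → ℝ) : Fin n → ℝ :=
  a ∘ Tuple.sort (fun i => -a i)

theorem antitone_decreasing {n : ℕ} (a : Fin n → ℝ) : Antitone (decreasing a) := by
  intro i j hij
  have := Tuple.monotone_sort (fun i => -a i) hij
  simpa [decreasing] using this

/-- `a ≺ b` for `a ∈ ℝ ^ n` and `b ∈ ℝ ^ m`. -/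
def IsMajorizedBy {n m : ℕ} (a : Fin n → ℝ) (b : Fin m → ℝ) : Prop :=
  (∀ r : ℕ, 1 ≤ r → r ≤ min n m →
    ∑ i ∈ Finset.univ.filter (fun i : Fin n => (i : ℕ) < r), decreasing a i ≤
      ∑ i ∈ Finset.univ.filter (fun i : Fin m => (i : ℕ) < r), decreasing b i) ∧
  ∑ i, a i = ∑ i, b i

/-! ### Shift-invariant subspaces of `L²(ℝ ^ k)` -/

/-- `ℝ ^ k` with the Euclidean structure. -/
abbrev Space (k : ℕ) : Type := EuclideanSpace ℝ (Fin k)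

/-- The complex Hilbert space `L²(ℝ ^ k)`. -/
abbrev L2 (k : ℕ) : Type := Lp ℂ 2 (volume : Measure (Space k))

/-- The complex Hilbert space `ℓ²(ℤ ^ k)`. -/
abbrev SeqSpace (k : ℕ) : Type := lp (fun _ : Fin k → ℤ => ℂ) 2

/-- The cube `[-1/2, 1/2) ^ k`. -/
def cube (k : ℕ) : Set (Space k) :=
  {x | ∀ i, x i ∈ Set.Ico (-(1 / 2) : ℝ) (1 / 2)}

/-- The torus `𝕋 ^ k = [-1/2, 1/2) ^ k`, with the Borel sigma-algebra and Lebesgue measure. -/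
abbrev Torus (k : ℕ) : Type := ↥(cube k)

/-- Lebesgue measure on the torus. -/
instance (k : ℕ) : MeasureSpace (Torus k) :=
  ⟨Measure.comap Subtype.val (volume : Measure (Space k))⟩

/-- `ℓ ∈ ℤ ^ k` as an element of `ℝ ^ k`. -/
def latticePoint {k : ℕ} (l : Fin k → ℤ) : Space k :=
  WithLp.toLp 2 (fun i => (l i : ℝ))

/-- The translation `(T_y f)(x) = f(x - y)` on `L²(ℝ ^ k)`. -/
def translation {k : ℕ} (y : Space k) : L2 k →ₗᵢ[ℂ] L2 k :=
  Lp.compMeasurePreservingₗᵢ ℂ (fun x => x - y) (measurePreserving_sub_right volume y)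

/-- The integer translates `E(F) = {T_ℓ f_i}_{(ℓ, i)}`. -/
def translates {k : ℕ} {ι : Type*} (F : ι → L2 k) : (Fin k → ℤ) × ι → L2 k :=
  fun p => translation (latticePoint p.1) (F p.2)

/-- The shift-invariant subspace `S(A)` generated by `A`: the closed linear span of all `T_ℓ f` with
`f ∈ A` and `ℓ ∈ ℤ ^ k`. -/
def shiftSpan {k : ℕ} (A : Set (L2 k)) : Submodule ℂ (L2 k) :=
  (Submodule.span ℂ
    {g | ∃ f ∈ A, ∃ l : Fin k → ℤ, g = translation (latticePoint l) f}).topologicalClosure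

/-- Finitely generated shift-invariant subspaces. -/
def IsFSI {k : ℕ} (W : Submodule ℂ (L2 k)) : Prop :=
  ∃ A : Set (L2 k), A.Finite ∧ W = shiftSpan A

open Classical in
/-- The fiber map `Γ f (x) = (f̂(x + ℓ))_ℓ`, where `f̂` is the Fourier transform on `L²(ℝ ^ k)` (with
kernel `exp (-2 π i ⟨y, x⟩)`). The sequence is square summable for almost every `x`; on the
remaining null set the value `0` is used. -/
def fiber {k : ℕ} (f : L2 k) (x : Torus k) : SeqSpace k :=
  if h : Memℓp (fun l : Fin k → ℤ => (𝓕 f : L2 k) (x.1 + latticePoint l)) 2 then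
    ⟨fun l => (𝓕 f : L2 k) (x.1 + latticePoint l), h⟩
  else 0

/-- `J` is a measurable range function and
`W = {f : Γ f (x) ∈ J(x) for almost every x}`. -/
def IsRangeFunction {k : ℕ} (W : Submodule ℂ (L2 k))
    (J : Torus k → ClosedSubmodule ℂ (SeqSpace k)) : Prop :=
  (∀ ξ η : SeqSpace k, Measurable fun x => ⟪η, (J x).toSubmodule.starProjection ξ⟫_ℂ) ∧
  ∀ f : L2 k, f ∈ W ↔ ∀ᵐ x : Torus k, fiber f x ∈ J x

open Classical in
/-- The measurable range function `J_W` of a shift-invariant subspace `W`. It exists and is unique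
up to a null set. (The value for a subspace that is not shift-invariant is irrelevant.) -/
def rangeFunction {k : ℕ} (W : Submodule ℂ (L2 k)) : Torus k → ClosedSubmodule ℂ (SeqSpace k) :=
  if h : ∃ J, IsRangeFunction W J then h.choose else fun _ => ⊥

/-- `d(x) = dim J_W(x)`. For a finitely generated `W` this dimension is finite almost everywhere. -/
def fiberDim {k : ℕ} (W : Submodule ℂ (L2 k)) (x : Torus k) : ℕ :=
  Module.finrank ℂ (rangeFunction W x).toSubmodule

/-- `s` is a weakly measurable, essentially bounded field of operators on `ℓ²(ℤ ^ k)` such that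
`s(x) (Γ f (x)) = Γ (S f) (x)` for almost every `x`, for every `f`. -/
def IsFiberField {k : ℕ} (S : L2 k →L[ℂ] L2 k)
    (s : Torus k → (SeqSpace k →L[ℂ] SeqSpace k)) : Prop :=
  (∀ ξ η : SeqSpace k, Measurable fun x => ⟪η, s x ξ⟫_ℂ) ∧
  (∃ C : ℝ, ∀ᵐ x : Torus k, ‖s x‖ ≤ C) ∧
  ∀ f : L2 k, ∀ᵐ x : Torus k, s x (fiber f x) = fiber (S f) x

open Classical in
/-- The field `x ↦ [S]_x` of a shift preserving operator `S`. It exists and is unique up to a null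
set. (The value for an operator that is not shift preserving is irrelevant.) -/
def fiberOperator {k : ℕ} (S : L2 k →L[ℂ] L2 k) : Torus k → (SeqSpace k →L[ℂ] SeqSpace k) :=
  if h : ∃ s, IsFiberField S s then h.choose else fun _ => 0

end ShiftGenerated

end

open ShiftGenerated

/-! The fiber map Γ is an isometry from L²(ℝ^k) onto the square integrable fields of vectors in
ℓ²(ℤ^k) over the torus, and it turns translation by ℓ into multiplication by a character. So the
numbers ⟨T_ℓ f, g⟩ are the Fourier coefficients of x ↦ ⟨Γf(x), Γg(x)⟩, and every notion becomes
fiberwise. E(F) is Bessel exactly when the fibers of the generators are essentially bounded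
(`ae_norm_fiber_sq_le`, `isBessel_translates`). The fiber of the frame operator is ∑_j Γf_j(x) ⊗
Γf_j(x)^* (`fiberOperator_frameOperator_ae`). An FSI space consists of the f whose fibers lie in the
span of the fibers of the generators (`mem_shiftSpan_iff`).

What remains is the Schur–Horn theorem in a space of dimension d, for n vectors v_j with squared
norms α_j and S = ∑ v_j ⊗ v_j^* with eigenvalues λ.

Necessity: if u_i are orthonormal eigenvectors for the positive λ_i, then ‖v_j‖² = ∑_i c_ij λ_i with
c_ij = |⟨u_i, v_j⟩|²/λ_i. Here ∑_j c_ij = 1 and ∑_i c_ij ≤ 1, so any r of the α_j sum to at most the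
r largest eigenvalues (`sum_norm_sq_le_of_isEigenvalueSequence`). Rank and trace give the rest.

Sufficiency: start from the orthogonal vectors √λ_i u_i. Choose p with λ_{p+1} ≤ α_0 ≤ λ_p, where
α_0 is the largest α, and rotate the vectors p and p+1 so that one of them gets squared norm α_0.
This leaves S unchanged. Set that vector aside; the others are still orthogonal and ordered and
still majorize the remaining α, so induction applies (`exists_schurHorn`).

Each choice is either an explicit formula or one of finitely many cases on measurable sets, and the
u_i come from Gram–Schmidt. Hence the vectors depend measurably on x (`exists_fields`), and Γ being
onto turns them into elements of W. -/

noncomputable section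

namespace ShiftGenerated

open scoped ENNReal

/-! ### The tiling of `ℝ ^ k` by the lattice translates of the cube -/

section Tiling

variable {k : ℕ}

@[simp] theorem latticePoint_apply (l : Fin k → ℤ) (i : Fin k) : latticePoint l i = (l i : ℝ) := rfl

/-- The lattice point `l` with `y - l` in the cube. -/
def nearestLattice (y : Space k) : Fin k → ℤ := fun i => ⌊y i + 1 / 2⌋

theorem nearestLattice_add_eq_iff (x : Space k) (l : Fin k → ℤ) :
    nearestLattice (x + latticePoint l) = l ↔ x ∈ cube k := by
  simp only [nearestLattice, funext_iff, cube, Set.mem_ofPred_eq, Set.mem_Ico, PiLp.add_apply,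
    latticePoint_apply, Int.floor_eq_iff]
  refine forall_congr' fun i => ?_
  constructor <;> rintro ⟨h1, h2⟩ <;> constructor <;> linarith

theorem sub_nearestLattice_mem (y : Space k) : y - latticePoint (nearestLattice y) ∈ cube k := by
  rw [← nearestLattice_add_eq_iff _ (nearestLattice y), sub_add_cancel]

theorem measurable_nearestLattice : Measurable (nearestLattice (k := k)) := by
  refine measurable_pi_lambda _ fun i => Int.measurable_floor.comp ?_
  fun_prop

theorem measurableSet_cube : MeasurableSet (cube k) := by
  have : cube k = {x | nearestLattice x = 0} := by
    ext x
    rw [← nearestLattice_add_eq_iff x 0, Set.mem_ofPred_eq]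
    have : latticePoint (0 : Fin k → ℤ) = 0 := by ext; simp
    rw [this, add_zero]
  rw [this]
  exact measurable_nearestLattice (measurableSet_singleton _)

theorem lintegral_torus (g : Space k → ℝ≥0∞) :
    ∫⁻ x : Torus k, g x.1 = ∫⁻ x in cube k, g x :=
  lintegral_subtype_comap measurableSet_cube g

/-- The level sets of `nearestLattice` are the disjoint lattice translates of the cube; translation
invariance moves each integral back to the cube. -/
theorem lintegral_eq_lintegral_tsum {g : Space k → ℝ≥0∞} (hg : Measurable g) :
    ∫⁻ y, g y = ∫⁻ x : Torus k, ∑' l : Fin k → ℤ, g (x.1 + latticePoint l) := by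
  have hm : ∀ l : Fin k → ℤ, MeasurableSet {y : Space k | nearestLattice y = l} :=
    fun l => measurable_nearestLattice (measurableSet_singleton l)
  have hU : (⋃ l : Fin k → ℤ, {y : Space k | nearestLattice y = l}) = Set.univ := by
    ext y; simp
  rw [← setLIntegral_univ, ← hU, lintegral_iUnion hm, lintegral_tsum]
  · congr 1
    ext l
    rw [lintegral_torus (fun x => g (x + latticePoint l)), ← lintegral_indicator (hm l),
      ← lintegral_indicator measurableSet_cube,
      ← lintegral_add_right_eq_self _ (latticePoint l)]
    congr 1
    ext x
    by_cases h : x ∈ cube k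
    · rw [Set.indicator_of_mem h, Set.indicator_of_mem]
      exact (nearestLattice_add_eq_iff x l).2 h
    · rw [Set.indicator_of_notMem h, Set.indicator_of_notMem]
      exact fun h' => h ((nearestLattice_add_eq_iff x l).1 h')
  · intro l
    exact (hg.comp (by fun_prop)).aemeasurable
  · intro l l' h
    refine Set.disjoint_left.2 fun y hy hy' => h ?_
    exact hy.symm.trans hy'

theorem ae_torus_of_ae {p : Space k → Prop} (hp : ∀ᵐ y, p y) :
    ∀ᵐ x : Torus k, ∀ l : Fin k → ℤ, p (x.1 + latticePoint l) := by
  obtain ⟨s, hs, hm, h0⟩ := exists_measurable_superset_of_null (ae_iff.1 hp)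
  -- Unfolding the indicator of a measurable null superset shows that almost no fiber x + ℤ^k meets
  -- the set.
  have h1 := lintegral_eq_lintegral_tsum (measurable_const.indicator hm : Measurable
    (s.indicator fun _ => (1 : ℝ≥0∞)))
  rw [lintegral_indicator hm, setLIntegral_one, h0, eq_comm, lintegral_eq_zero_iff] at h1
  · filter_upwards [h1] with x hx l
    have := (ENNReal.tsum_eq_zero.1 hx) l
    by_contra hc
    have h2 : x.1 + latticePoint l ∈ s := hs hc
    simp [h2] at this
  · refine Measurable.tsum fun l => ?_
    exact (measurable_const.indicator hm).comp (by fun_prop)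

theorem volume_cube : volume (cube k) = 1 := by
  have : cube k = (WithLp.ofLp : Space k → _) ⁻¹'
      (Set.univ.pi fun _ => Set.Ico (-(1 / 2) : ℝ) (1 / 2)) := by
    ext x; simp [cube]
  rw [this, (PiLp.volume_preserving_ofLp (Fin k)).measure_preimage
    (MeasurableSet.univ_pi fun _ => measurableSet_Ico).nullMeasurableSet, volume_pi_pi]
  norm_num

instance isProbabilityMeasure_torus : IsProbabilityMeasure (volume : Measure (Torus k)) := by
  constructor
  rw [← setLIntegral_one, setLIntegral_univ, lintegral_torus (fun _ => 1), setLIntegral_one,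
    volume_cube]

end Tiling

/-! ### The fiber map -/

section Fiber

variable {k : ℕ}

theorem enorm_sq_eq_tsum (v : SeqSpace k) : ‖v‖ₑ ^ 2 = ∑' l, ‖v l‖ₑ ^ 2 := by
  have h := lp.hasSum_norm (p := 2) (by norm_num) v
  simp only [ENNReal.toReal_ofNat, Real.rpow_ofNat] at h
  have h2 := ENNReal.ofReal_tsum_of_nonneg (fun l => by positivity) h.summable
  rw [h.tsum_eq] at h2
  simpa [ENNReal.ofReal_pow, ofReal_norm] using h2

theorem memℓp_two_iff (a : (Fin k → ℤ) → ℂ) : Memℓp a 2 ↔ ∑' l, ‖a l‖ₑ ^ 2 < ∞ := by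
  rw [memℓp_gen_iff (by norm_num)]
  simp only [ENNReal.toReal_ofNat, Real.rpow_ofNat]
  constructor
  · intro h
    have h2 := ENNReal.ofReal_tsum_of_nonneg (fun l => by positivity) h
    simp only [ENNReal.ofReal_pow (norm_nonneg _), ofReal_norm] at h2
    rw [← h2]
    exact ENNReal.ofReal_lt_top
  · intro h
    have := ENNReal.summable_toReal h.ne
    simpa using this

/-- Coordinatewise measurability of a field of sequences. -/
def CoordMeasurable {Ω : Type*} [MeasurableSpace Ω] (v : Ω → SeqSpace k) : Prop :=
  ∀ l, Measurable fun x => v x l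

namespace CoordMeasurable

variable {Ω : Type*} [MeasurableSpace Ω] {u v : Ω → SeqSpace k}

theorem const (v : SeqSpace k) : CoordMeasurable (fun _ : Ω => v) := fun _ => measurable_const

theorem zero : CoordMeasurable (fun _ : Ω => (0 : SeqSpace k)) := const 0

theorem add (hu : CoordMeasurable u) (hv : CoordMeasurable v) :
    CoordMeasurable fun x => u x + v x := fun l => (hu l).add (hv l)

theorem sub (hu : CoordMeasurable u) (hv : CoordMeasurable v) :
    CoordMeasurable fun x => u x - v x := fun l => (hu l).sub (hv l)

theorem smul {c : Ω → ℂ} (hc : Measurable c) (hv : CoordMeasurable v) :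
    CoordMeasurable fun x => c x • v x := fun l => hc.mul (hv l)

theorem sum {ι : Type*} {s : Finset ι} {f : ι → Ω → SeqSpace k}
    (hf : ∀ i ∈ s, CoordMeasurable (f i)) : CoordMeasurable fun x => ∑ i ∈ s, f i x := by
  classical
  induction s using Finset.induction_on with
  | empty => simpa using zero
  | insert i s hi ih =>
    simp only [Finset.sum_insert hi]
    exact (hf i (Finset.mem_insert_self i s)).add
      (ih fun j hj => hf j (Finset.mem_insert_of_mem hj))

theorem inner (hu : CoordMeasurable u) (hv : CoordMeasurable v) :
    Measurable fun x => ⟪u x, v x⟫_ℂ := by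
  -- The inner product is the limit of its finite partial sums, each measurable coordinatewise.
  refine measurable_of_tendsto_metrizable'
    (f := fun s : Finset (Fin k → ℤ) => fun x => ∑ l ∈ s, ⟪u x l, v x l⟫_ℂ) Filter.atTop ?_ ?_
  · intro s
    refine Finset.measurable_sum s fun l _ => ?_
    simp only [RCLike.inner_apply]
    exact (hv l).mul (Complex.continuous_conj.measurable.comp (hu l))
  · rw [tendsto_pi_nhds]
    exact fun x => lp.hasSum_inner (u x) (v x)

theorem norm (hv : CoordMeasurable v) : Measurable fun x => ‖v x‖ := by
  have := (hv.inner hv).norm.sqrt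
  convert! this using 1
  ext x
  rw [inner_self_eq_norm_sq_to_K]
  simp

theorem enorm (hv : CoordMeasurable v) : Measurable fun x => ‖v x‖ₑ := by
  simp_rw [← ofReal_norm]
  exact hv.norm.ennreal_ofReal

theorem ite {p : Ω → Prop} [DecidablePred p] (hp : MeasurableSet {x | p x})
    (hu : CoordMeasurable u) (hv : CoordMeasurable v) :
    CoordMeasurable fun x => if p x then u x else v x := by
  intro l
  have h : Measurable fun x => if p x then u x l else v x l :=
    Measurable.ite hp (hu l) (hv l)
  convert! h using 1
  ext x
  by_cases h : p x <;> simp [h]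

end CoordMeasurable

theorem measurable_coeFn (f : L2 k) : Measurable (f : Space k → ℂ) :=
  (Lp.stronglyMeasurable f).measurable

theorem coordMeasurable_fiber (f : L2 k) : CoordMeasurable (fiber f) := by
  classical
  intro l
  have h1 : ∀ l : Fin k → ℤ, Measurable fun x : Torus k => (𝓕 f : L2 k) (x.1 + latticePoint l) :=
    fun l => (measurable_coeFn _).comp (by fun_prop)
  -- The fallback value 0 is taken on a measurable set, so it does not spoil measurability.
  have h2 : MeasurableSet {x : Torus k |
      Memℓp (fun l : Fin k → ℤ => (𝓕 f : L2 k) (x.1 + latticePoint l)) 2} := by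
    simp_rw [memℓp_two_iff]
    exact measurableSet_lt (Measurable.tsum fun l => ((h1 l).enorm.pow_const 2))
      measurable_const
  have h3 : Measurable fun x : Torus k =>
      if Memℓp (fun l : Fin k → ℤ => (𝓕 f : L2 k) (x.1 + latticePoint l)) 2 then
        (𝓕 f : L2 k) (x.1 + latticePoint l) else 0 :=
    Measurable.ite h2 (h1 l) measurable_const
  convert! h3 using 1
  ext x
  unfold fiber
  split_ifs <;> rfl

theorem lintegral_enorm_sq_L2 (f : L2 k) : ∫⁻ y, ‖f y‖ₑ ^ 2 = ‖f‖ₑ ^ 2 := by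
  rw [Lp.enorm_def, eLpNorm_eq_lintegral_rpow_enorm_toReal (by norm_num) (by norm_num)]
  simp only [ENNReal.toReal_ofNat, ENNReal.rpow_ofNat]
  rw [← ENNReal.rpow_natCast, ← ENNReal.rpow_mul]
  norm_num

/-- Unfolding ∫ |f̂|² over the cube makes the sum over each fiber finite almost everywhere, so the
default value in `fiber` occurs only on a null set. -/
theorem fiber_apply_ae (f : L2 k) :
    ∀ᵐ x : Torus k, ∀ l, fiber f x l = (𝓕 f : L2 k) (x.1 + latticePoint l) := by
  have h := lintegral_enorm_sq_L2 (𝓕 f)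
  rw [lintegral_eq_lintegral_tsum ((measurable_coeFn _).enorm.pow_const 2)] at h
  have h1 := ae_lt_top (Measurable.tsum fun l =>
    (((measurable_coeFn _).comp (by fun_prop)).enorm.pow_const 2))
    (h.trans_ne (by simp [enorm_ne_top]))
  filter_upwards [h1] with x hx l
  have : Memℓp (fun l : Fin k → ℤ => (𝓕 f : L2 k) (x.1 + latticePoint l)) 2 :=
    (memℓp_two_iff _).2 hx
  rw [fiber, dif_pos this]

/-- Plancherel followed by unfolding: Γ is isometric. -/
theorem lintegral_enorm_fiber_sq (f : L2 k) : ∫⁻ x : Torus k, ‖fiber f x‖ₑ ^ 2 = ‖f‖ₑ ^ 2 := by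
  have h := lintegral_enorm_sq_L2 (𝓕 f)
  rw [lintegral_eq_lintegral_tsum ((measurable_coeFn _).enorm.pow_const 2)] at h
  have h3 : ‖𝓕 f‖ₑ = ‖f‖ₑ := by rw [← ofReal_norm, ← ofReal_norm, Lp.norm_fourier_eq]
  rw [← h3, ← h]
  refine lintegral_congr_ae ?_
  filter_upwards [fiber_apply_ae f] with x hx
  simp only [enorm_sq_eq_tsum, hx]

theorem integrable_norm_fiber_sq (f : L2 k) : Integrable fun x : Torus k => ‖fiber f x‖ ^ 2 := by
  refine ⟨((coordMeasurable_fiber f).norm.pow_const 2).aestronglyMeasurable, ?_⟩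
  rw [HasFiniteIntegral]
  simp only [enorm_pow, enorm_norm]
  rw [lintegral_enorm_fiber_sq]
  exact ENNReal.pow_lt_top enorm_lt_top

theorem integral_norm_fiber_sq (f : L2 k) : ∫ x : Torus k, ‖fiber f x‖ ^ 2 = ‖f‖ ^ 2 := by
  rw [integral_eq_lintegral_of_nonneg_ae (Filter.Eventually.of_forall fun x => by positivity)
    (integrable_norm_fiber_sq f).aestronglyMeasurable]
  simp only [ENNReal.ofReal_pow (norm_nonneg _), ofReal_norm]
  rw [lintegral_enorm_fiber_sq]
  simp

theorem fiber_add_ae (f g : L2 k) : ∀ᵐ x : Torus k, fiber (f + g) x = fiber f x + fiber g x := by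
  filter_upwards [fiber_apply_ae f, fiber_apply_ae g, fiber_apply_ae (f + g),
    ae_torus_of_ae (Lp.coeFn_add (𝓕 f) (𝓕 g))] with x h1 h2 h3 h4
  ext l
  rw [h3, FourierTransform.fourier_add, h4, lp.coeFn_add, Pi.add_apply, Pi.add_apply, h1, h2]

theorem fiber_smul_ae (c : ℂ) (f : L2 k) : ∀ᵐ x : Torus k, fiber (c • f) x = c • fiber f x := by
  filter_upwards [fiber_apply_ae f, fiber_apply_ae (c • f),
    ae_torus_of_ae (Lp.coeFn_smul c (𝓕 f))] with x h1 h2 h3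
  ext l
  rw [h2, FourierTransform.fourier_smul, h3, lp.coeFn_smul, Pi.smul_apply, Pi.smul_apply, h1]

theorem fiber_sub_ae (f g : L2 k) : ∀ᵐ x : Torus k, fiber (f - g) x = fiber f x - fiber g x := by
  filter_upwards [fiber_add_ae (f - g) g] with x hx
  rw [sub_add_cancel] at hx
  rw [hx, add_sub_cancel_right]

theorem eq_of_fiber_ae_eq {f g : L2 k} (h : ∀ᵐ x : Torus k, fiber f x = fiber g x) : f = g := by
  have h1 : ∀ᵐ x : Torus k, ‖fiber (f - g) x‖ₑ ^ 2 = 0 := by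
    filter_upwards [h, fiber_sub_ae f g] with x h1 h2
    rw [h2, h1]
    simp
  have h2 := lintegral_enorm_fiber_sq (f - g)
  rw [lintegral_congr_ae h1, lintegral_zero] at h2
  simpa [sub_eq_zero] using h2.symm

theorem inner_eq_norm_sq (u v : SeqSpace k) : ⟪u, v⟫_ℂ =
    ((‖u + v‖ ^ 2 : ℝ) - (‖u - v‖ ^ 2 : ℝ) + ((‖u - Complex.I • v‖ ^ 2 : ℝ) -
      (‖u + Complex.I • v‖ ^ 2 : ℝ)) * Complex.I) / 4 := by
  have := inner_eq_sum_norm_sq_div_four (𝕜 := ℂ) u v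
  simpa using this

theorem integrable_inner_fiber_and_integral (f g : L2 k) :
    Integrable (fun x : Torus k => ⟪fiber f x, fiber g x⟫_ℂ) ∧
      ∫ x : Torus k, ⟪fiber f x, fiber g x⟫_ℂ = ⟪f, g⟫_ℂ := by
  -- Polarization reduces the inner product to the norms already integrated.
  have key : ∀ᵐ x : Torus k, ⟪fiber f x, fiber g x⟫_ℂ =
      ((‖fiber (f + g) x‖ ^ 2 : ℝ) - (‖fiber (f - g) x‖ ^ 2 : ℝ) +
        ((‖fiber (f - Complex.I • g) x‖ ^ 2 : ℝ) -
        (‖fiber (f + Complex.I • g) x‖ ^ 2 : ℝ)) * Complex.I) / 4 := by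
    filter_upwards [fiber_add_ae f g, fiber_sub_ae f g, fiber_sub_ae f (Complex.I • g),
      fiber_add_ae f (Complex.I • g), fiber_smul_ae Complex.I g] with x h1 h2 h3 h4 h5
    rw [h1, h2, h3, h4, h5]
    exact inner_eq_norm_sq _ _
  have hi : ∀ h : L2 k, Integrable fun x : Torus k => ((‖fiber h x‖ ^ 2 : ℝ) : ℂ) :=
    fun h => (integrable_norm_fiber_sq h).ofReal
  constructor
  · refine Integrable.congr ?_ (key.mono fun x hx => hx.symm)
    exact (((hi _).sub (hi _)).add (((hi _).sub (hi _)).mul_const _)).div_const _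
  · rw [integral_congr_ae key, integral_div]
    erw [integral_add ((hi _).sub (hi _)) (((hi _).sub (hi _)).mul_const _), integral_mul_const]
    simp only [Pi.sub_apply, integral_sub (hi _) (hi _)]
    simp only [integral_complex_ofReal, integral_norm_fiber_sq]
    rw [inner_eq_sum_norm_sq_div_four (𝕜 := ℂ) f g]
    simp

theorem integrable_inner_fiber (f g : L2 k) :
    Integrable (fun x : Torus k => ⟪fiber f x, fiber g x⟫_ℂ) :=
  (integrable_inner_fiber_and_integral f g).1

theorem integral_inner_fiber (f g : L2 k) :
    ∫ x : Torus k, ⟪fiber f x, fiber g x⟫_ℂ = ⟪f, g⟫_ℂ :=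
  (integrable_inner_fiber_and_integral f g).2

/-- Surjectivity of Γ: the coordinates of the field are laid out on the lattice translates of the
cube, and the resulting function on ℝ^k is transformed back. -/
theorem exists_fiber_eq {v : Torus k → SeqSpace k} (hv : CoordMeasurable v)
    (hfin : ∫⁻ x, ‖v x‖ₑ ^ 2 < ∞) : ∃ f : L2 k, ∀ᵐ x : Torus k, fiber f x = v x := by
  set h : Space k → ℂ := fun y =>
    v ⟨y - latticePoint (nearestLattice y), sub_nearestLattice_mem y⟩ (nearestLattice y) with hh
  have hval : ∀ (x : Torus k) (l : Fin k → ℤ), h (x.1 + latticePoint l) = v x l := by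
    intro x l
    have : nearestLattice (x.1 + latticePoint l) = l := (nearestLattice_add_eq_iff _ _).2 x.2
    simp only [hh]
    have h2 : (⟨x.1 + latticePoint l - latticePoint (nearestLattice (x.1 + latticePoint l)),
        sub_nearestLattice_mem _⟩ : Torus k) = x := by
      refine Subtype.ext ?_
      simp only [this, add_sub_cancel_right]
    rw [h2, this]
  have hmeas : Measurable h := by
    have h1 : Measurable fun p : Torus k × (Fin k → ℤ) => v p.1 p.2 :=
      measurable_from_prod_countable_left fun l => hv l
    have h2 : Measurable fun y : Space k => (⟨y - latticePoint (nearestLattice y),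
        sub_nearestLattice_mem y⟩ : Torus k) := by
      refine Measurable.subtype_mk (measurable_id.sub ?_)
      exact (measurable_of_countable (latticePoint (k := k))).comp measurable_nearestLattice
    exact h1.comp (h2.prodMk measurable_nearestLattice)
  have hmem : MemLp h 2 volume := by
    refine ⟨hmeas.aestronglyMeasurable, ?_⟩
    rw [eLpNorm_lt_top_iff_lintegral_rpow_enorm_lt_top (by norm_num) (by norm_num)]
    simp only [ENNReal.toReal_ofNat, ENNReal.rpow_ofNat]
    rw [lintegral_eq_lintegral_tsum (hmeas.enorm.pow_const 2)]
    simpa only [hval, ← enorm_sq_eq_tsum] using hfin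
  refine ⟨𝓕⁻ hmem.toLp, ?_⟩
  filter_upwards [fiber_apply_ae (𝓕⁻ hmem.toLp), ae_torus_of_ae hmem.coeFn_toLp] with x h1 h2
  ext l
  rw [h1, FourierTransform.fourier_fourierInv_eq, h2, hval]

end Fiber

open UnitAddTorus

/-! ### Fourier series on the torus -/

section FourierSeries

/-- Lebesgue measure on `ℝ / ℤ`, normalised as in Mathlib's theory of Fourier series. -/
local instance : MeasureSpace UnitAddCircle := ⟨AddCircle.haarAddCircle⟩

local instance : Measure.IsAddHaarMeasure (volume : Measure UnitAddCircle) :=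
  inferInstanceAs (Measure.IsAddHaarMeasure AddCircle.haarAddCircle)

variable {k : ℕ}

/-- Uniqueness of Fourier coefficients is needed for integrable functions, since an inner product of
two fibers is in general only in L¹. Hence the argument by duality with continuous functions instead
of Parseval. -/
theorem ae_eq_zero_of_mFourierCoeff_eq_zero {g : UnitAddTorus (Fin k) → ℂ} (hg : Integrable g)
    (h : ∀ l, ∫ t, mFourier l t * g t = 0) : g =ᵐ[volume] 0 := by
  have hi : ∀ c : C(UnitAddTorus (Fin k), ℂ), Integrable fun t => c t * g t := fun c =>
    hg.bdd_mul (c := ‖c‖) c.continuous.aestronglyMeasurable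
      (Filter.Eventually.of_forall fun t => c.norm_coe_le_norm t)
  let Λ : C(UnitAddTorus (Fin k), ℂ) →L[ℂ] ℂ := LinearMap.mkContinuous
    { toFun := fun c => ∫ t, c t * g t
      map_add' := fun c c' => by
        simp only [ContinuousMap.add_apply, add_mul]
        exact integral_add (hi c) (hi c')
      map_smul' := fun a c => by
        simp only [ContinuousMap.smul_apply, smul_eq_mul, mul_assoc, RingHom.id_apply]
        exact integral_const_mul _ _ } (∫ t, ‖g t‖) (fun c => by
      refine (norm_integral_le_integral_norm _).trans ?_
      change ∫ t, ‖c t * g t‖ ≤ _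
      rw [mul_comm, ← integral_const_mul]
      refine integral_mono (hi c).norm (hg.norm.const_mul _) fun t => ?_
      simp only [norm_mul]
      exact mul_le_mul_of_nonneg_right (c.norm_coe_le_norm t) (norm_nonneg _))
  have hΛ : ∀ c, Λ c = 0 := by
    intro c
    -- Trigonometric polynomials are dense in the continuous functions, so the functional Λ vanishes
    -- identically.
    have h1 : Submodule.span ℂ (Set.range (mFourier (d := Fin k))) ≤ Λ.toLinearMap.ker := by
      rw [Submodule.span_le]
      rintro _ ⟨l, rfl⟩
      exact h l
    have h2 := Submodule.topologicalClosure_minimal _ h1 Λ.isClosed_ker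
    rw [span_mFourier_closure_eq_top] at h2
    exact h2 trivial
  refine ae_eq_zero_of_forall_setIntegral_isClosed_eq_zero hg fun K hK => ?_
  -- Indicators of closed sets are bounded pointwise limits of continuous functions, so the integral
  -- of g over every closed set vanishes.
  have hlim := tendsto_integral_of_dominated_convergence (μ := volume)
    (F := fun (m : ℕ) t => (((thickenedIndicator (Nat.one_div_pos_of_nat (α := ℝ) (n := m)) K) t :
      ℝ≥0) : ℂ) * g t) (f := K.indicator g) (fun t => ‖g t‖) ?_ hg.norm ?_ ?_
  · rw [← integral_indicator hK.measurableSet]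
    refine tendsto_nhds_unique hlim ?_
    convert! tendsto_const_nhds using 2
    rename_i m
    let c : C(UnitAddTorus (Fin k), ℂ) :=
      ⟨fun t => (((thickenedIndicator (Nat.one_div_pos_of_nat (α := ℝ) (n := m)) K) t : ℝ≥0) : ℂ),
        by fun_prop⟩
    exact hΛ c
  · intro m
    exact (Continuous.aestronglyMeasurable (by fun_prop)).mul hg.aestronglyMeasurable
  · refine fun m => Filter.Eventually.of_forall fun t => ?_
    rw [norm_mul]
    refine mul_le_of_le_one_left (norm_nonneg _) ?_
    simpa using thickenedIndicator_le_one (Nat.one_div_pos_of_nat (α := ℝ) (n := m)) K t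
  · refine Filter.Eventually.of_forall fun t => ?_
    have h1 := thickenedIndicator_tendsto_indicator_closure (δseq := fun m : ℕ => 1 / ((m : ℝ) + 1))
      (fun m => Nat.one_div_pos_of_nat) tendsto_one_div_add_atTop_nhds_zero_nat K
    rw [tendsto_pi_nhds] at h1
    have h2 := h1 t
    rw [hK.closure_eq] at h2
    have h3 : K.indicator g t = ((K.indicator (fun _ => (1 : ℝ≥0)) t : ℝ≥0) : ℂ) * g t := by
      by_cases ht : t ∈ K <;> simp [ht]
    rw [h3]
    refine Filter.Tendsto.mul_const _ ?_
    exact ((Complex.continuous_ofReal.comp NNReal.continuous_coe).tendsto _).comp h2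

/-- The reduction of the coordinates of a point of `ℝ ^ k` modulo `1`. -/
def toUnit (x : Space k) : UnitAddTorus (Fin k) := fun i => (x i : UnitAddCircle)

theorem toUnit_add_latticePoint (x : Space k) (l : Fin k → ℤ) :
    toUnit (x + latticePoint l) = toUnit x := by
  ext i
  simp only [toUnit, PiLp.add_apply, latticePoint_apply, AddCircle.coe_add]
  have : ((l i : ℝ) : UnitAddCircle) = 0 := by
    rw [AddCircle.coe_eq_zero_iff]
    exact ⟨l i, by simp⟩
  rw [this, add_zero]

@[fun_prop] theorem measurable_toUnit : Measurable (toUnit (k := k)) :=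
  measurable_pi_lambda _ fun i => AddCircle.measurable_mk'.comp (by fun_prop)

theorem injective_toUnit_torus : Function.Injective fun x : Torus k => toUnit x.1 := by
  intro x y h
  ext i
  have h1 := congr_fun h i
  have hx := x.2 i
  have hy := y.2 i
  have : Fact ((0 : ℝ) < 1) := ⟨one_pos⟩
  have h2 : (-(1 / 2) + 1 : ℝ) = 1 / 2 := by norm_num
  exact (AddCircle.coe_eq_coe_iff_of_mem_Ico (a := -(1 / 2)) (p := (1 : ℝ))
    (by rwa [h2]) (by rwa [h2])).1 h1

theorem measurePreserving_toUnit :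
    MeasurePreserving (fun x : Torus k => toUnit x.1) volume volume := by
  have h1 : MeasurePreserving (Subtype.val : Torus k → Space k) volume
      (volume.restrict (cube k)) := measurePreserving_subtype_coe measurableSet_cube
  have h2 : MeasurePreserving (WithLp.ofLp : Space k → Fin k → ℝ) (volume.restrict (cube k))
      (volume.restrict (Set.univ.pi fun _ => Set.Ico (-(1 / 2) : ℝ) (1 / 2))) := by
    have := (PiLp.volume_preserving_ofLp (Fin k)).restrict_preimage
      (s := Set.univ.pi fun _ => Set.Ico (-(1 / 2) : ℝ) (1 / 2))
      (MeasurableSet.univ_pi fun _ => measurableSet_Ico)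
    convert! this using 2
    ext x; simp [cube]
  have h3 : MeasurePreserving (fun (x : Fin k → ℝ) (i : Fin k) => (x i : UnitAddCircle))
      (volume.restrict (Set.univ.pi fun _ => Set.Ico (-(1 / 2) : ℝ) (1 / 2))) volume := by
    rw [volume_pi, Measure.restrict_pi_pi]
    refine measurePreserving_pi _ _ fun i => ?_
    rw [restrict_Ico_eq_restrict_Ioc]
    convert! AddCircle.measurePreserving_mk 1 (-(1 / 2)) using 1
    · norm_num
    · rw [AddCircle.volume_eq_smul_haarAddCircle]
      simp [volume]
  exact (h3.comp h2).comp h1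

/-- The half-open cube is not homeomorphic to the torus group in general, but an injective
measurable map out of a standard Borel space is enough to transport integrals. -/
theorem measurableEmbedding_toUnit : MeasurableEmbedding fun x : Torus k => toUnit x.1 := by
  have : StandardBorelSpace (Torus k) := measurableSet_cube.standardBorel
  exact (measurable_toUnit.comp measurable_subtype_coe).measurableEmbedding injective_toUnit_torus

/-- The character `x ↦ exp (2 π i ⟨l, x⟩)` of the torus. -/
def torusChar (l : Fin k → ℤ) (x : Torus k) : ℂ := mFourier l (toUnit x.1)

theorem conj_torusChar (l : Fin k → ℤ) (x : Torus k) :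
    starRingEnd ℂ (torusChar l x) = torusChar (-l) x := mFourier_neg.symm

theorem ae_eq_zero_of_integral_torusChar {g : Torus k → ℂ} (hg : Integrable g)
    (h : ∀ l, ∫ x, torusChar l x * g x = 0) : g =ᵐ[volume] 0 := by
  have hq := measurableEmbedding_toUnit (k := k)
  set G : UnitAddTorus (Fin k) → ℂ := Function.extend (fun x : Torus k => toUnit x.1) g 0 with hG
  have hGq : ∀ x : Torus k, G (toUnit x.1) = g x := fun x =>
    injective_toUnit_torus.extend_apply g 0 x
  have h1 : Integrable G :=
    (measurePreserving_toUnit.integrable_comp_emb hq).1 (hg.congr (ae_of_all _ fun x =>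
      (hGq x).symm))
  have h2 : G =ᵐ[volume] 0 := by
    refine ae_eq_zero_of_mFourierCoeff_eq_zero h1 fun l => ?_
    rw [← measurePreserving_toUnit.integral_comp hq]
    simpa only [hGq, torusChar] using h l
  filter_upwards [measurePreserving_toUnit.quasiMeasurePreserving.ae h2] with x hx
  rw [← hGq, hx]
  rfl

theorem hasSum_integral_torusChar {a b : Torus k → ℂ} (ha : MemLp a 2) (hb : MemLp b 2) :
    HasSum (fun l => starRingEnd ℂ (∫ x, torusChar l x * a x) * ∫ x, torusChar l x * b x)
      (∫ x, starRingEnd ℂ (a x) * b x) := by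
  have hq := measurableEmbedding_toUnit (k := k)
  have ext : ∀ g : Torus k → ℂ, MemLp g 2 → ∃ G : Lp ℂ 2 (volume : Measure (UnitAddTorus (Fin k))),
      ∀ᵐ x : Torus k, G (toUnit x.1) = g x := by
    intro g hg
    have hGq : ∀ x : Torus k,
        Function.extend (fun x : Torus k => toUnit x.1) g 0 (toUnit x.1) = g x := fun x =>
      injective_toUnit_torus.extend_apply g 0 x
    have hm : MemLp (Function.extend (fun x : Torus k => toUnit x.1) g 0) 2 volume := by
      rw [← measurePreserving_toUnit.map_eq, hq.memLp_map_measure_iff]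
      exact hg.ae_eq (ae_of_all _ fun x => (hGq x).symm)
    refine ⟨hm.toLp, ?_⟩
    filter_upwards [measurePreserving_toUnit.quasiMeasurePreserving.ae hm.coeFn_toLp] with x hx
    rw [hx, hGq]
  obtain ⟨A, hA⟩ := ext a ha
  obtain ⟨B, hB⟩ := ext b hb
  have key := hasSum_prod_mFourierCoeff A B
  rw [← measurePreserving_toUnit.integral_comp hq] at key
  have e1 : ∫ x, starRingEnd ℂ (a x) * b x =
      ∫ x : Torus k, starRingEnd ℂ (A (toUnit x.1)) * B (toUnit x.1) := by
    refine integral_congr_ae ?_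
    filter_upwards [hA, hB] with x h1 h2
    rw [h1, h2]
  have e2 : ∀ {g : Torus k → ℂ} {G : Lp ℂ 2 (volume : Measure (UnitAddTorus (Fin k)))},
      (∀ᵐ x : Torus k, G (toUnit x.1) = g x) → ∀ l,
      ∫ x, torusChar l x * g x = mFourierCoeff G (-l) := by
    intro g G h l
    rw [mFourierCoeff, ← measurePreserving_toUnit.integral_comp hq, neg_neg]
    refine integral_congr_ae ?_
    filter_upwards [h] with x hx
    simp [hx, torusChar]
  rw [e1]
  simp_rw [e2 hA, e2 hB]
  -- Pairing with the character l gives the Fourier coefficient of index -l, so Parseval is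
  -- reindexed by negation.
  exact (Equiv.neg (Fin k → ℤ)).hasSum_iff.2 key

end FourierSeries

/-! ### Translations and fibers -/

section Translation

variable {k : ℕ}

theorem fourierChar_inner_latticePoint (l : Fin k → ℤ) (ξ : Space k) :
    ((Real.fourierChar (-⟪latticePoint l, ξ⟫_ℝ) : Circle) : ℂ) = mFourier (-l) (toUnit ξ) := by
  simp only [mFourier, ContinuousMap.coe_mk, toUnit, fourier_coe_apply, ← Complex.exp_sum,
    Real.fourierChar_apply, PiLp.inner_apply, RCLike.inner_apply, latticePoint_apply]
  congr 1
  simp only [Pi.neg_apply, conj_trivial]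
  push_cast
  rw [← Finset.sum_neg_distrib, Finset.mul_sum, Finset.sum_mul]
  refine Finset.sum_congr rfl fun i _ => ?_
  ring

theorem memLp_modulation (y : Space k) (f : L2 k) :
    MemLp (fun ξ => ((Real.fourierChar (-⟪y, ξ⟫_ℝ) : Circle) : ℂ) * f ξ) 2 volume :=
  (Lp.memLp f).of_le ((Continuous.aestronglyMeasurable (by fun_prop)).mul
    (Lp.aestronglyMeasurable f)) (ae_of_all _ fun ξ => by
      rw [norm_mul, Circle.norm_coe, one_mul])

/-- Multiplication by the character `ξ ↦ exp (- 2 π i ⟨y, ξ⟩)`. -/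
def modulation (y : Space k) : L2 k →ₗᵢ[ℂ] L2 k where
  toFun f := (memLp_modulation y f).toLp
  map_add' f g := by
    rw [← MemLp.toLp_add, MemLp.toLp_eq_toLp_iff]
    filter_upwards [Lp.coeFn_add f g] with ξ h
    rw [h, Pi.add_apply, Pi.add_apply, mul_add]
  map_smul' c f := by
    rw [RingHom.id_apply, ← MemLp.toLp_const_smul, MemLp.toLp_eq_toLp_iff]
    filter_upwards [Lp.coeFn_smul c f] with ξ h
    rw [h, Pi.smul_apply, Pi.smul_apply, smul_eq_mul, smul_eq_mul, mul_left_comm]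
  norm_map' f := by
    change ‖(memLp_modulation y f).toLp‖ = _
    rw [Lp.norm_toLp, Lp.norm_def]
    congr 1
    exact eLpNorm_congr_norm_ae (ae_of_all _ fun ξ => by
      rw [norm_mul, Circle.norm_coe, one_mul])

theorem coeFn_modulation (y : Space k) (f : L2 k) :
    modulation y f =ᵐ[volume] fun ξ => ((Real.fourierChar (-⟪y, ξ⟫_ℝ) : Circle) : ℂ) * f ξ :=
  (memLp_modulation y f).coeFn_toLp

/-- Both sides are continuous in f, so the integral formula on the dense Schwartz functions decides.
-/
theorem fourier_translation (y : Space k) (f : L2 k) :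
    𝓕 (translation y f) = modulation y (𝓕 f) := by
  refine DenseRange.induction_on (p := fun f : L2 k => 𝓕 (translation y f) = modulation y (𝓕 f))
    (SchwartzMap.denseRange_toLpCLM (E := Space k) (F := ℂ) (p := 2)
      (μ := volume) ENNReal.ofNat_ne_top) f ?_ ?_
  · have hc : Continuous (fun f : L2 k => (𝓕 f : L2 k)) := (Lp.fourierTransformₗᵢ _ _).continuous
    exact isClosed_eq (hc.comp (translation y).continuous) ((modulation y).continuous.comp hc)
  · intro φ
    rw [SchwartzMap.toLpCLM_apply]
    have h1 : translation y (φ.toLp 2) = (φ.compSubConstCLM ℂ y).toLp 2 := by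
      refine Lp.ext ?_
      have h2 := Lp.coeFn_compMeasurePreserving (φ.toLp 2 : L2 k)
        (measurePreserving_sub_right volume y)
      have h3 := (measurePreserving_sub_right (volume : Measure (Space k)) y).quasiMeasurePreserving.ae
        (φ.coeFn_toLp 2 volume)
      filter_upwards [h2, h3, (φ.compSubConstCLM ℂ y).coeFn_toLp 2 volume] with x h2 h3 h4
      rw [h4, SchwartzMap.compSubConstCLM_apply, ← h3]
      exact h2
    rw [h1, SchwartzMap.toLp_fourier_eq, SchwartzMap.toLp_fourier_eq]
    refine Lp.ext ?_
    filter_upwards [coeFn_modulation y ((𝓕 φ).toLp 2), (𝓕 φ).coeFn_toLp 2 volume,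
      (𝓕 (φ.compSubConstCLM ℂ y)).coeFn_toLp 2 volume] with ξ h2 h3 h4
    rw [h2, h3, h4, SchwartzMap.fourier_coe, SchwartzMap.fourier_coe]
    have := congr_fun (VectorFourier.fourierIntegral_comp_add_right Real.fourierChar
      (volume : Measure (Space k)) (innerₗ (Space k)) φ (-y)) ξ
    simp only [innerₗ_apply_apply, inner_neg_left] at this
    rw [Real.fourier_eq, Real.fourier_eq]
    convert! this using 1

theorem fiber_translation_ae (l : Fin k → ℤ) (f : L2 k) :
    ∀ᵐ x : Torus k, fiber (translation (latticePoint l) f) x = torusChar (-l) x • fiber f x := by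
  filter_upwards [fiber_apply_ae f, fiber_apply_ae (translation (latticePoint l) f),
    ae_torus_of_ae (coeFn_modulation (latticePoint l) (𝓕 f))] with x h1 h2 h3
  ext m
  rw [h2, fourier_translation, h3, lp.coeFn_smul, Pi.smul_apply, h1,
    fourierChar_inner_latticePoint, toUnit_add_latticePoint, smul_eq_mul]
  rfl

/-- The bridge to Fourier series: characters are constant along x + ℤ^k, so a translation acts on
each fiber by a scalar. -/
theorem inner_translation_eq_integral (l : Fin k → ℤ) (f g : L2 k) :
    ⟪translation (latticePoint l) f, g⟫_ℂ =
      ∫ x : Torus k, torusChar l x * ⟪fiber f x, fiber g x⟫_ℂ := by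
  rw [← integral_inner_fiber]
  refine integral_congr_ae ?_
  filter_upwards [fiber_translation_ae l f] with x hx
  rw [hx, inner_smul_left, conj_torusChar, neg_neg]

end Translation

/-! ### Frame operators of finite families and fibers of frame operators -/

section FiberField

variable {k n : ℕ}

/-- The operator `∑ j, w j ⊗ (w j)^*`. -/
def frameSum {n : ℕ} {H : Type*} [NormedAddCommGroup H] [InnerProductSpace ℂ H] (w : Fin n → H) :
    H →L[ℂ] H :=
  ∑ j, InnerProductSpace.rankOne ℂ (w j) (w j)

theorem frameSum_apply {H : Type*} [NormedAddCommGroup H] [InnerProductSpace ℂ H]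
    (w : Fin n → H) (g : H) : frameSum w g = ∑ j, ⟪w j, g⟫_ℂ • w j := by
  simp [frameSum]

theorem norm_frameSum_le {H : Type*} [NormedAddCommGroup H] [InnerProductSpace ℂ H]
    (w : Fin n → H) : ‖frameSum w‖ ≤ ∑ j, ‖w j‖ ^ 2 := by
  refine (norm_sum_le _ _).trans (le_of_eq ?_)
  simp [pow_two]

theorem memLp_inner_fiber {f g : L2 k} {b : ℝ} (hf : ∀ᵐ x : Torus k, ‖fiber f x‖ ^ 2 ≤ b) :
    MemLp (fun x : Torus k => ⟪fiber f x, fiber g x⟫_ℂ) 2 := by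
  have hm := ((coordMeasurable_fiber f).inner (coordMeasurable_fiber g)).aestronglyMeasurable
    (μ := volume)
  rw [memLp_two_iff_integrable_sq_norm hm]
  refine ((integrable_norm_fiber_sq g).const_mul b).mono' (hm.norm.pow 2) ?_
  filter_upwards [hf] with x hx
  rw [Real.norm_of_nonneg (by positivity)]
  calc ‖⟪fiber f x, fiber g x⟫_ℂ‖ ^ 2 ≤ (‖fiber f x‖ * ‖fiber g x‖) ^ 2 := by
        gcongr; exact norm_inner_le_norm _ _
    _ = ‖fiber f x‖ ^ 2 * ‖fiber g x‖ ^ 2 := mul_pow _ _ _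
    _ ≤ b * ‖fiber g x‖ ^ 2 := by gcongr

theorem hasSum_inner_translation {f g h : L2 k}
    (hg : MemLp (fun x : Torus k => ⟪fiber f x, fiber g x⟫_ℂ) 2)
    (hh : MemLp (fun x : Torus k => ⟪fiber f x, fiber h x⟫_ℂ) 2) :
    HasSum (fun l => starRingEnd ℂ ⟪translation (latticePoint l) f, g⟫_ℂ *
        ⟪translation (latticePoint l) f, h⟫_ℂ)
      (∫ x : Torus k, starRingEnd ℂ ⟪fiber f x, fiber g x⟫_ℂ * ⟪fiber f x, fiber h x⟫_ℂ) := by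
  simp_rw [inner_translation_eq_integral]
  exact hasSum_integral_torusChar hg hh

theorem hasSum_norm_inner_translation_sq {f g : L2 k}
    (hg : MemLp (fun x : Torus k => ⟪fiber f x, fiber g x⟫_ℂ) 2) :
    HasSum (fun l => ‖⟪translation (latticePoint l) f, g⟫_ℂ‖ ^ 2)
      (∫ x : Torus k, ‖⟪fiber f x, fiber g x⟫_ℂ‖ ^ 2) := by
  have h := hasSum_inner_translation hg hg
  simp only [RCLike.conj_mul, ← RCLike.ofReal_pow] at h
  rw [integral_ofReal] at h
  exact (RCLike.hasSum_ofReal ℂ).1 h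

theorem exists_fiber_eq_of_bounded {v : Torus k → SeqSpace k} (hv : CoordMeasurable v) {C : ℝ}
    (hC : ∀ᵐ x, ‖v x‖ ^ 2 ≤ C) : ∃ f : L2 k, ∀ᵐ x : Torus k, fiber f x = v x := by
  refine exists_fiber_eq hv (lt_of_le_of_lt (lintegral_mono_ae (g := fun _ => ENNReal.ofReal C) ?_)
    ?_)
  · filter_upwards [hC] with x hx
    rw [← ofReal_norm, ← ENNReal.ofReal_pow (norm_nonneg _)]
    exact ENNReal.ofReal_le_ofReal hx
  · simp

/-- The Bessel inequality is tested on the part of f living over the set where the bound would fail.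
-/
theorem ae_norm_fiber_sq_le {b : ℝ} (hb : 0 < b) {f : L2 k}
    (h : ∀ g : L2 k, Summable (fun l => ‖⟪translation (latticePoint l) f, g⟫_ℂ‖ ^ 2) →
      ∑' l, ‖⟪translation (latticePoint l) f, g⟫_ℂ‖ ^ 2 ≤ b * ‖g‖ ^ 2) :
    ∀ᵐ x : Torus k, ‖fiber f x‖ ^ 2 ≤ b := by
  classical
  have hm : ∀ m : ℕ, ∀ᵐ x : Torus k, ¬ (b < ‖fiber f x‖ ^ 2 ∧ ‖fiber f x‖ ^ 2 ≤ m) := by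
    intro m
    -- The upper cutoff m keeps the test field bounded, so it is a fiber field and Parseval applies;
    -- the cutoffs are exhausted at the end.
    set p : Torus k → Prop := fun x => b < ‖fiber f x‖ ^ 2 ∧ ‖fiber f x‖ ^ 2 ≤ m with hp
    have hpm : MeasurableSet {x | p x} := by
      have := (coordMeasurable_fiber f).norm.pow_const 2
      exact (measurableSet_lt measurable_const this).inter (measurableSet_le this measurable_const)
    have hvm : CoordMeasurable fun x => if p x then fiber f x else 0 :=
      CoordMeasurable.ite hpm (coordMeasurable_fiber f) CoordMeasurable.zero
    have hvb : ∀ x, ‖if p x then fiber f x else 0‖ ^ 2 ≤ (m : ℝ) := by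
      intro x
      split_ifs with hx
      · exact hx.2
      · simp
    obtain ⟨g, hg⟩ := exists_fiber_eq_of_bounded hvm (ae_of_all _ hvb)
    have hinner : ∀ᵐ x : Torus k, ⟪fiber f x, fiber g x⟫_ℂ =
        ((‖fiber g x‖ ^ 2 : ℝ) : ℂ) := by
      filter_upwards [hg] with x hx
      rw [hx]
      split_ifs
      · simp
      · simp
    have hL : MemLp (fun x : Torus k => ⟪fiber f x, fiber g x⟫_ℂ) 2 := by
      refine MemLp.of_bound ((coordMeasurable_fiber f).inner
        (coordMeasurable_fiber g)).aestronglyMeasurable (m : ℝ) ?_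
      filter_upwards [hinner, hg] with x h1 h2
      rw [h1, h2, Complex.norm_real, Real.norm_of_nonneg (by positivity)]
      exact hvb x
    have hs := hasSum_norm_inner_translation_sq hL
    have h1 := h g hs.summable
    rw [hs.tsum_eq, ← integral_norm_fiber_sq, ← integral_const_mul] at h1
    have hint := (memLp_two_iff_integrable_sq_norm hL.1).1 hL
    have h2 : ∫ x : Torus k, (‖⟪fiber f x, fiber g x⟫_ℂ‖ ^ 2 - b * ‖fiber g x‖ ^ 2) ≤ 0 := by
      rw [integral_sub hint ((integrable_norm_fiber_sq g).const_mul b)]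
      linarith
    -- The integrand is nonnegative, and strictly positive where p holds, while its integral is at
    -- most 0; so p fails almost everywhere.
    have hval : ∀ᵐ x : Torus k, ‖⟪fiber f x, fiber g x⟫_ℂ‖ ^ 2 - b * ‖fiber g x‖ ^ 2 =
        if p x then ‖fiber f x‖ ^ 2 * (‖fiber f x‖ ^ 2 - b) else 0 := by
      filter_upwards [hinner, hg] with x h1 h2
      rw [h1, h2, Complex.norm_real, Real.norm_of_nonneg (by positivity)]
      split_ifs
      · ring
      · simp
    have h3 : 0 ≤ᵐ[volume] fun x : Torus k =>
        ‖⟪fiber f x, fiber g x⟫_ℂ‖ ^ 2 - b * ‖fiber g x‖ ^ 2 := by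
      filter_upwards [hval] with x hx
      rw [hx]
      split_ifs with hx
      · exact mul_nonneg (by positivity) (sub_nonneg.2 hx.1.le)
      · exact le_rfl
    have h4 := (integral_eq_zero_iff_of_nonneg_ae h3
      (hint.sub ((integrable_norm_fiber_sq g).const_mul b))).1 (le_antisymm h2
        (integral_nonneg_of_ae h3))
    filter_upwards [h4, hval] with x h5 h6 hpx
    rw [h6, if_pos hpx, Pi.zero_apply] at h5
    have := mul_pos (hb.trans hpx.1) (sub_pos.2 hpx.1)
    exact this.ne' h5
  filter_upwards [ae_all_iff.2 hm] with x hx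
  obtain ⟨m, hm⟩ := exists_nat_ge (‖fiber f x‖ ^ 2)
  by_contra hc
  exact hx m ⟨not_le.1 hc, hm⟩

theorem ae_norm_fiber_sq_le_of_isBessel {F : Fin n → L2 k} (hB : IsBessel (translates F)) :
    ∃ b : ℝ, 0 < b ∧ ∀ᵐ x : Torus k, ∀ j, ‖fiber (F j) x‖ ^ 2 ≤ b := by
  obtain ⟨b, hb, h⟩ := hB
  refine ⟨b, hb, ae_all_iff.2 fun j => ae_norm_fiber_sq_le hb fun g hg => ?_⟩
  have hinj : Function.Injective fun l : Fin k → ℤ => (l, j) :=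
    fun a b hab => congr_arg Prod.fst hab
  refine (hg.tsum_le_tsum_of_inj (g := fun i => ‖⟪translates F i, g⟫_ℂ‖ ^ 2) _ hinj
    (fun i _ => sq_nonneg _) (fun l => le_of_eq ?_) (h g).1).trans (h g).2
  rw [translates]

theorem isBessel_translates {F : Fin n → L2 k} {b : ℝ}
    (hF : ∀ᵐ x : Torus k, ∀ j, ‖fiber (F j) x‖ ^ 2 ≤ b) : IsBessel (translates F) := by
  have hj : ∀ j, ∀ᵐ x : Torus k, ‖fiber (F j) x‖ ^ 2 ≤ b := ae_all_iff.1 hF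
  have key : ∀ j (g : L2 k), ∫ x : Torus k, ‖⟪fiber (F j) x, fiber g x⟫_ℂ‖ ^ 2 ≤
      |b| * ‖g‖ ^ 2 := by
    intro j g
    have hL := memLp_inner_fiber (g := g) (hj j)
    rw [← integral_norm_fiber_sq, ← integral_const_mul]
    refine integral_mono_ae ((memLp_two_iff_integrable_sq_norm hL.1).1 hL)
      ((integrable_norm_fiber_sq g).const_mul _) ?_
    filter_upwards [hj j] with x hx
    calc ‖⟪fiber (F j) x, fiber g x⟫_ℂ‖ ^ 2 ≤ (‖fiber (F j) x‖ * ‖fiber g x‖) ^ 2 := by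
          gcongr; exact norm_inner_le_norm _ _
      _ = ‖fiber (F j) x‖ ^ 2 * ‖fiber g x‖ ^ 2 := mul_pow _ _ _
      _ ≤ |b| * ‖fiber g x‖ ^ 2 := by
          gcongr; exact hx.trans (le_abs_self b)
  -- The summand 1 makes the bound positive even when n = 0 or b = 0.
  refine ⟨n * |b| + 1, by positivity, fun g => ?_⟩
  have hs : ∀ j, HasSum (fun l => ‖⟪translation (latticePoint l) (F j), g⟫_ℂ‖ ^ 2) _ :=
    fun j => hasSum_norm_inner_translation_sq (memLp_inner_fiber (hj j))
  have hsum := hasSum_sum fun j (_ : j ∈ Finset.univ) => hs j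
  have hS : Summable fun i => ‖⟪translates F i, g⟫_ℂ‖ ^ 2 := by
    rw [summable_prod_of_nonneg fun _ => by positivity]
    refine ⟨fun l => Summable.of_finite, ?_⟩
    simpa only [translates, tsum_fintype] using hsum.summable
  refine ⟨hS, ?_⟩
  rw [hS.tsum_prod' fun l => Summable.of_finite]
  simp only [translates, tsum_fintype]
  rw [hsum.tsum_eq]
  refine (Finset.sum_le_sum fun j _ => key j g).trans ?_
  rw [Finset.sum_const, Finset.card_univ, Fintype.card_fin, nsmul_eq_mul]
  nlinarith [sq_nonneg ‖g‖]

/-- ⟨Sg, h⟩ is the inner product of the two analysis sequences; Parseval turns it into an integral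
for each generator. -/
theorem inner_frameOperator_translates {F : Fin n → L2 k} (hB : IsBessel (translates F))
    (g h : L2 k) : ⟪frameOperator (translates F) hB g, h⟫_ℂ =
      ∫ x : Torus k, ⟪frameSum (fun j => fiber (F j) x) (fiber g x), fiber h x⟫_ℂ := by
  obtain ⟨b, -, hb⟩ := ae_norm_fiber_sq_le_of_isBessel hB
  have hL : ∀ j (g : L2 k), MemLp (fun x : Torus k => ⟪fiber (F j) x, fiber g x⟫_ℂ) 2 :=
    fun j g => memLp_inner_fiber (ae_all_iff.1 hb j)
  have h1 : HasSum (fun i => starRingEnd ℂ ⟪translates F i, g⟫_ℂ * ⟪translates F i, h⟫_ℂ)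
      ⟪frameOperator (translates F) hB g, h⟫_ℂ := by
    have := lp.hasSum_inner (𝕜 := ℂ) (analysisOperator (translates F) hB g)
      (analysisOperator (translates F) hB h)
    rw [frameOperator, synthesisOperator, ContinuousLinearMap.comp_apply,
      ContinuousLinearMap.adjoint_inner_left]
    simpa only [analysisOperator_apply, RCLike.inner_apply'] using this
  have h2 := h1.prod_fiberwise fun l => hasSum_fintype _
  have h3 := hasSum_sum fun j (_ : j ∈ Finset.univ) => hasSum_inner_translation (hL j g) (hL j h)
  rw [h2.unique h3, ← integral_finsetSum]
  · simp only [frameSum_apply, sum_inner, inner_smul_left]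
  · intro j _
    exact MemLp.integrable_mul (hL j g).star (hL j h)

theorem coordMeasurable_frameSum {Ω : Type*} [MeasurableSpace Ω] {w : Fin n → Ω → SeqSpace k}
    {g : Ω → SeqSpace k} (hw : ∀ j, CoordMeasurable (w j)) (hg : CoordMeasurable g) :
    CoordMeasurable fun x => frameSum (fun j => w j x) (g x) := by
  simp only [frameSum_apply]
  exact CoordMeasurable.sum fun j _ => CoordMeasurable.smul ((hw j).inner hg) (hw j)

theorem isFiberField_frameOperator {F : Fin n → L2 k} (hB : IsBessel (translates F)) :
    IsFiberField (frameOperator (translates F) hB)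
      (fun x => frameSum fun j => fiber (F j) x) := by
  obtain ⟨b, hb0, hb⟩ := ae_norm_fiber_sq_le_of_isBessel hB
  have hbound : ∀ᵐ x : Torus k, ‖frameSum fun j => fiber (F j) x‖ ≤ n * b := by
    filter_upwards [hb] with x hx
    refine (norm_frameSum_le _).trans ((Finset.sum_le_sum fun j _ => hx j).trans ?_)
    simp
  refine ⟨fun ξ η => ?_, ⟨n * b, hbound⟩, fun f => ?_⟩
  · exact (CoordMeasurable.const η).inner
      (coordMeasurable_frameSum (fun j => coordMeasurable_fiber (F j)) (CoordMeasurable.const ξ))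
  -- The element u with the expected fibers is identified with Sf by testing both against every h.
  · obtain ⟨u, hu⟩ := exists_fiber_eq
      (coordMeasurable_frameSum (fun j => coordMeasurable_fiber (F j)) (coordMeasurable_fiber f)) (by
        refine lt_of_le_of_lt (lintegral_mono_ae (g := fun x : Torus k =>
          ENNReal.ofReal (n * b) ^ 2 * ‖fiber f x‖ₑ ^ 2) ?_) ?_
        · filter_upwards [hbound] with x hx
          rw [← mul_pow]
          gcongr
          rw [← ofReal_norm, ← ofReal_norm, ← ENNReal.ofReal_mul (by positivity)]
          exact ENNReal.ofReal_le_ofReal (ContinuousLinearMap.le_of_opNorm_le _ hx _)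
        · rw [lintegral_const_mul _ ((coordMeasurable_fiber f).enorm.pow_const 2),
            lintegral_enorm_fiber_sq]
          exact ENNReal.mul_lt_top (ENNReal.pow_lt_top ENNReal.ofReal_lt_top)
            (ENNReal.pow_lt_top enorm_lt_top))
    have : u = frameOperator (translates F) hB f := by
      refine ext_inner_right ℂ fun h => ?_
      rw [inner_frameOperator_translates, ← integral_inner_fiber]
      refine integral_congr_ae ?_
      filter_upwards [hu] with x hx
      rw [hx]
    rw [← this]
    exact hu.mono fun x hx => hx.symm

theorem exists_fiber_eq_const (ξ : SeqSpace k) :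
    ∃ f : L2 k, ∀ᵐ x : Torus k, fiber f x = ξ :=
  exists_fiber_eq_of_bounded (CoordMeasurable.const ξ) (ae_of_all _ fun _ => le_rfl)

/-- Constant fields are fibers, so both fields agree on each unit vector almost everywhere. There
are countably many of these, and they determine a bounded operator. -/
theorem IsFiberField.ae_eq {S : L2 k →L[ℂ] L2 k} {s s' : Torus k → SeqSpace k →L[ℂ] SeqSpace k}
    (hs : IsFiberField S s) (hs' : IsFiberField S s') : ∀ᵐ x, s x = s' x := by
  classical
  choose f hf using fun l : Fin k → ℤ => exists_fiber_eq_const (lp.single 2 l (1 : ℂ))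
  filter_upwards [ae_all_iff.2 hf, ae_all_iff.2 fun l => hs.2.2 (f l),
    ae_all_iff.2 fun l => hs'.2.2 (f l)] with x h1 h2 h3
  refine lp.ext_continuousLinearMap (by norm_num) fun l => ?_
  ext1
  have := (h2 l).trans (h3 l).symm
  rw [h1] at this
  exact this

theorem fiberOperator_frameOperator_ae {F : Fin n → L2 k} (hB : IsBessel (translates F)) :
    ∀ᵐ x : Torus k, fiberOperator (frameOperator (translates F) hB) x =
      frameSum fun j => fiber (F j) x := by
  have h : ∃ s, IsFiberField (frameOperator (translates F) hB) s :=
    ⟨_, isFiberField_frameOperator hB⟩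
  rw [fiberOperator, dif_pos h]
  exact h.choose_spec.ae_eq (isFiberField_frameOperator hB)

end FiberField

/-! ### Range functions of finitely generated shift-invariant spaces -/

section Range

variable {k m : ℕ}

instance finiteDimensional_span_range {H : Type*} [NormedAddCommGroup H] [InnerProductSpace ℂ H]
    (f : Fin m → H) : FiniteDimensional ℂ (Submodule.span ℂ (Set.range f)) :=
  FiniteDimensional.span_of_finite ℂ (Set.finite_range f)

theorem frameSum_apply_self {H : Type*} [NormedAddCommGroup H] [InnerProductSpace ℂ H]
    {e : Fin m → H} (he : Pairwise fun i j => ⟪e i, e j⟫_ℂ = 0)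
    (he1 : ∀ i, e i ≠ 0 → ‖e i‖ = 1) (i : Fin m) : frameSum e (e i) = e i := by
  rw [frameSum_apply, Finset.sum_eq_single i]
  · by_cases h : e i = 0
    · simp [h]
    · rw [inner_self_eq_norm_sq_to_K, he1 i h]
      simp
  · intro j _ hj
    rw [he hj, zero_smul]
  · simp

theorem mem_orthogonal_span_range {H : Type*} [NormedAddCommGroup H] [InnerProductSpace ℂ H]
    {f : Fin m → H} {v : H} (h : ∀ i, ⟪f i, v⟫_ℂ = 0) : v ∈ (Submodule.span ℂ (Set.range f))ᗮ := by
  rw [Submodule.mem_orthogonal]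
  intro u hu
  refine Submodule.span_induction (p := fun u _ => ⟪u, v⟫_ℂ = 0) ?_ ?_ ?_ ?_ hu
  · rintro _ ⟨i, rfl⟩
    exact h i
  · simp
  · intro x y _ _ hx hy
    rw [inner_add_left, hx, hy, add_zero]
  · intro c x _ hx
    rw [inner_smul_left, hx, mul_zero]

/-- Zero vectors are permitted because Gram–Schmidt returns 0 at a linearly dependent entry; the
formula then needs no case distinction on the rank. -/
theorem frameSum_eq_starProjection {H : Type*} [NormedAddCommGroup H] [InnerProductSpace ℂ H]
    {e : Fin m → H} (he : Pairwise fun i j => ⟪e i, e j⟫_ℂ = 0)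
    (he1 : ∀ i, e i ≠ 0 → ‖e i‖ = 1) (g : H) :
    (Submodule.span ℂ (Set.range e)).starProjection g = frameSum e g := by
  suffices h : frameSum e g ∈ Submodule.span ℂ (Set.range e) ∧
      g - frameSum e g ∈ (Submodule.span ℂ (Set.range e))ᗮ from
    (Submodule.eq_starProjection_of_mem_orthogonal h.1 h.2)
  constructor
  · rw [frameSum_apply]
    exact Submodule.sum_mem _ fun i _ =>
      Submodule.smul_mem _ _ (Submodule.subset_span (Set.mem_range_self i))
  · refine mem_orthogonal_span_range fun i => ?_
    have : ⟪e i, frameSum e g⟫_ℂ = ⟪frameSum e (e i), g⟫_ℂ := by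
      rw [frameSum_apply, frameSum_apply, sum_inner, inner_sum]
      refine Finset.sum_congr rfl fun j _ => ?_
      rw [inner_smul_left, inner_smul_right, inner_conj_symm, mul_comm]
    rw [inner_sub_right, this, frameSum_apply_self he he1, sub_self]

/-! ### Measurable Gram–Schmidt and projections onto spans of fields -/

section GramSchmidt

variable {H : Type*} [NormedAddCommGroup H] [InnerProductSpace ℂ H]

theorem gramSchmidtNormed_inner_eq_zero (f : Fin m → H) :
    Pairwise fun i j => ⟪InnerProductSpace.gramSchmidtNormed ℂ f i,
      InnerProductSpace.gramSchmidtNormed ℂ f j⟫_ℂ = 0 := by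
  intro i j hij
  simp [InnerProductSpace.gramSchmidtNormed, InnerProductSpace.gramSchmidt_orthogonal ℂ f hij]

theorem span_range_gramSchmidtNormed (f : Fin m → H) :
    Submodule.span ℂ (Set.range (InnerProductSpace.gramSchmidtNormed ℂ f)) =
      Submodule.span ℂ (Set.range f) := by
  rw [InnerProductSpace.span_gramSchmidtNormed_range, InnerProductSpace.span_gramSchmidt]

end GramSchmidt

theorem CoordMeasurable.gramSchmidt {Ω : Type*} [MeasurableSpace Ω] {v : Fin m → Ω → SeqSpace k}
    (hv : ∀ i, CoordMeasurable (v i)) (i : Fin m) :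
    CoordMeasurable fun x => InnerProductSpace.gramSchmidt ℂ (fun j => v j x) i := by
  induction i using WellFoundedLT.induction with
  | ind i ih =>
    -- Written as a quotient, the projection coefficient is measurable also where the earlier vector
    -- vanishes, since division by 0 gives 0.
    have heq : ∀ x, InnerProductSpace.gramSchmidt ℂ (fun j => v j x) i = v i x -
        ∑ j ∈ Finset.Iio i, (⟪InnerProductSpace.gramSchmidt ℂ (fun j => v j x) j, v i x⟫_ℂ /
          ((‖InnerProductSpace.gramSchmidt ℂ (fun j => v j x) j‖ ^ 2 : ℝ) : ℂ)) •
          InnerProductSpace.gramSchmidt ℂ (fun j => v j x) j := by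
      intro x
      rw [InnerProductSpace.gramSchmidt_def]
      simp only [Submodule.starProjection_singleton]
      rfl
    simp only [heq]
    refine (hv i).sub (CoordMeasurable.sum fun j hj => ?_)
    have h := ih j (Finset.mem_Iio.1 hj)
    refine CoordMeasurable.smul ((h.inner (hv i)).div ?_) h
    exact Complex.measurable_ofReal.comp (h.norm.pow_const 2)

theorem CoordMeasurable.gramSchmidtNormed {Ω : Type*} [MeasurableSpace Ω]
    {v : Fin m → Ω → SeqSpace k} (hv : ∀ i, CoordMeasurable (v i)) (i : Fin m) :
    CoordMeasurable fun x => InnerProductSpace.gramSchmidtNormed ℂ (fun j => v j x) i := by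
  have h := CoordMeasurable.gramSchmidt hv i
  exact CoordMeasurable.smul (Complex.measurable_ofReal.comp h.norm).inv h

theorem starProjection_span_eq_frameSum {H : Type*} [NormedAddCommGroup H] [InnerProductSpace ℂ H]
    (f : Fin m → H) (g : H) : (Submodule.span ℂ (Set.range f)).starProjection g =
      frameSum (InnerProductSpace.gramSchmidtNormed ℂ f) g := by
  rw [← frameSum_eq_starProjection (gramSchmidtNormed_inner_eq_zero f)
    fun i => InnerProductSpace.gramSchmidtNormed_unit_length']
  congr! 2
  exact (span_range_gramSchmidtNormed f).symm

theorem coordMeasurable_starProjection_span {Ω : Type*} [MeasurableSpace Ω]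
    {v : Fin m → Ω → SeqSpace k} {g : Ω → SeqSpace k} (hv : ∀ i, CoordMeasurable (v i))
    (hg : CoordMeasurable g) : CoordMeasurable fun x =>
      (Submodule.span ℂ (Set.range fun i => v i x)).starProjection (g x) := by
  simp only [starProjection_span_eq_frameSum]
  exact coordMeasurable_frameSum (CoordMeasurable.gramSchmidtNormed hv) hg

/-- Orthogonality to all translates says that all Fourier coefficients of x ↦ ⟨Γφ_i(x), Γv(x)⟩
vanish, hence the function itself. -/
theorem mem_orthogonal_shiftSpan_iff (φ : Fin m → L2 k) (v : L2 k) :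
    v ∈ (shiftSpan (Set.range φ))ᗮ ↔ ∀ᵐ x : Torus k, ∀ i, ⟪fiber (φ i) x, fiber v x⟫_ℂ = 0 := by
  rw [shiftSpan, Submodule.orthogonal_closure, Submodule.mem_orthogonal]
  have h1 : (∀ u ∈ Submodule.span ℂ {g | ∃ f ∈ Set.range φ, ∃ l : Fin k → ℤ,
      g = translation (latticePoint l) f}, ⟪u, v⟫_ℂ = 0) ↔
      ∀ i (l : Fin k → ℤ), ⟪translation (latticePoint l) (φ i), v⟫_ℂ = 0 := by
    constructor
    · exact fun h i l => h _ (Submodule.subset_span ⟨φ i, ⟨i, rfl⟩, l, rfl⟩)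
    · intro h u hu
      refine Submodule.span_induction (p := fun u _ => ⟪u, v⟫_ℂ = 0) ?_ ?_ ?_ ?_ hu
      · rintro _ ⟨_, ⟨i, rfl⟩, l, rfl⟩
        exact h i l
      · simp
      · intro x y _ _ hx hy
        rw [inner_add_left, hx, hy, add_zero]
      · intro c x _ hx
        rw [inner_smul_left, hx, mul_zero]
  rw [h1, ae_all_iff]
  refine forall_congr' fun i => ?_
  simp only [inner_translation_eq_integral]
  constructor
  · exact ae_eq_zero_of_integral_torusChar (integrable_inner_fiber (φ i) v)
  · intro h l
    rw [integral_eq_zero_of_ae]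
    filter_upwards [h] with x hx
    rw [hx, mul_zero, Pi.zero_apply]

/-- Projecting each fiber of f onto the span gives the fibers of some w. Then f - w is orthogonal to
the shift span, and w is orthogonal to its complement, so w is the orthogonal projection of f. -/
theorem mem_shiftSpan_iff (φ : Fin m → L2 k) (f : L2 k) : f ∈ shiftSpan (Set.range φ) ↔
    ∀ᵐ x : Torus k, fiber f x ∈ Submodule.span ℂ (Set.range fun i => fiber (φ i) x) := by
  set J : Torus k → Submodule ℂ (SeqSpace k) :=
    fun x => Submodule.span ℂ (Set.range fun i => fiber (φ i) x) with hJ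
  have hfin : ∀ x, FiniteDimensional ℂ (J x) := fun x => finiteDimensional_span_range _
  have hmem : ∀ i x, fiber (φ i) x ∈ J x := fun i x => Submodule.subset_span ⟨i, rfl⟩
  have hclosed : IsClosed (shiftSpan (Set.range φ) : Set (L2 k)) :=
    Submodule.isClosed_topologicalClosure _
  have : CompleteSpace (shiftSpan (Set.range φ)) := hclosed.completeSpace_coe
  have hproj : CoordMeasurable fun x => (J x).starProjection (fiber f x) :=
    coordMeasurable_starProjection_span (fun i => coordMeasurable_fiber (φ i))
      (coordMeasurable_fiber f)
  obtain ⟨w, hw⟩ : ∃ w : L2 k, ∀ᵐ x, fiber w x = (J x).starProjection (fiber f x) := by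
    refine exists_fiber_eq hproj (lt_of_le_of_lt (lintegral_mono fun x => ?_)
      ((lintegral_enorm_fiber_sq f).trans_lt (ENNReal.pow_lt_top enorm_lt_top)))
    gcongr
    rw [← ofReal_norm, ← ofReal_norm]
    exact ENNReal.ofReal_le_ofReal (Submodule.norm_starProjection_apply_le _ _)
  have hres : ∀ᵐ x : Torus k, fiber (f - w) x = fiber f x - (J x).starProjection (fiber f x) := by
    filter_upwards [hw, fiber_sub_ae f w] with x h1 h2
    rw [h2, h1]
  have hperp : f - w ∈ (shiftSpan (Set.range φ))ᗮ := by
    rw [mem_orthogonal_shiftSpan_iff]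
    filter_upwards [hres] with x hx i
    rw [hx]
    exact (Submodule.mem_orthogonal _ _).1 (Submodule.sub_starProjection_mem_orthogonal _) _
      (hmem i x)
  have hw_mem : w ∈ shiftSpan (Set.range φ) := by
    rw [← Submodule.orthogonal_orthogonal (shiftSpan (Set.range φ)), Submodule.mem_orthogonal]
    intro v hv
    rw [mem_orthogonal_shiftSpan_iff] at hv
    rw [← integral_inner_fiber]
    refine integral_eq_zero_of_ae ?_
    filter_upwards [hv, hw] with x h1 h2
    have h3 : fiber v x ∈ (J x)ᗮ := mem_orthogonal_span_range h1
    rw [h2, Pi.zero_apply]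
    exact (Submodule.mem_orthogonal' _ _).1 h3 _ (Submodule.starProjection_apply_mem _ _)
  constructor
  · intro hf
    have h1 : f - w = 0 := by
      have h2 : ⟪f - w, f - w⟫_ℂ = 0 :=
        (Submodule.mem_orthogonal _ _).1 hperp _ (Submodule.sub_mem _ hf hw_mem)
      exact inner_self_eq_zero.1 h2
    filter_upwards [hw] with x hx
    rw [sub_eq_zero.1 h1, hx]
    exact Submodule.starProjection_apply_mem _ _
  · intro hf
    have h1 : f = w := by
      refine eq_of_fiber_ae_eq ?_
      filter_upwards [hw, hf] with x h1 h2
      rw [h1, Submodule.starProjection_eq_self_iff.2 h2]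
    rw [h1]
    exact hw_mem

theorem isRangeFunction_shiftSpan (φ : Fin m → L2 k) :
    IsRangeFunction (shiftSpan (Set.range φ)) fun x =>
      ⟨Submodule.span ℂ (Set.range fun i => fiber (φ i) x),
        Submodule.closed_of_finiteDimensional _⟩ := by
  refine ⟨fun ξ η => ?_, fun f => mem_shiftSpan_iff φ f⟩
  exact (CoordMeasurable.const η).inner (coordMeasurable_starProjection_span
    (fun i => coordMeasurable_fiber (φ i)) (CoordMeasurable.const ξ))

open Classical in
/-- The standard unit vectors of `ℓ²(ℤ ^ k)`. -/
def unitSeq (l : Fin k → ℤ) : SeqSpace k := lp.single 2 l (1 : ℂ)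

theorem inner_unitSeq_left (l : Fin k → ℤ) (v : SeqSpace k) : ⟪unitSeq l, v⟫_ℂ = v l := by
  rw [unitSeq, lp.inner_single_left, RCLike.inner_apply, map_one, mul_one]

theorem norm_unitSeq (l : Fin k → ℤ) : ‖unitSeq l‖ = 1 := by
  rw [unitSeq, lp.norm_single (by norm_num), norm_one]

/-- The projections of the unit vectors onto J(x) are fibers of countably many elements of W, so off
one null set they lie in J'(x); they span a dense part of J(x). -/
theorem IsRangeFunction.ae_le {W : Submodule ℂ (L2 k)}
    {J J' : Torus k → ClosedSubmodule ℂ (SeqSpace k)} (hJ : IsRangeFunction W J)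
    (hJ' : IsRangeFunction W J') : ∀ᵐ x, (J x).toSubmodule ≤ (J' x).toSubmodule := by
  classical
  have hm : ∀ l : Fin k → ℤ, CoordMeasurable fun x =>
      (J x).toSubmodule.starProjection (unitSeq l) := by
    intro l l'
    have := hJ.1 (unitSeq l) (unitSeq l')
    simpa only [inner_unitSeq_left] using this
  have hb : ∀ (l : Fin k → ℤ) x,
      ‖(J x).toSubmodule.starProjection (unitSeq l)‖ ^ 2 ≤ 1 := by
    intro l x
    have h1 := (J x).toSubmodule.norm_starProjection_apply_le (unitSeq l)
    rw [norm_unitSeq] at h1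
    exact pow_le_one₀ (norm_nonneg _) h1
  choose f hf using fun l => exists_fiber_eq_of_bounded (hm l) (ae_of_all _ (hb l))
  have hW : ∀ l, f l ∈ W := by
    intro l
    rw [hJ.2]
    filter_upwards [hf l] with x hx
    rw [hx]
    exact Submodule.starProjection_apply_mem _ _
  filter_upwards [ae_all_iff.2 hf, ae_all_iff.2 fun l => (hJ'.2 (f l)).1 (hW l)] with x h1 h2
  intro v hv
  have h3 := (lp.hasSum_single (by norm_num) v).mapL (J x).toSubmodule.starProjection
  rw [Submodule.starProjection_eq_self_iff.2 hv] at h3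
  have hcl : IsClosed ((J' x).toSubmodule : Set (SeqSpace k)) := (J' x).isClosed'
  refine hcl.mem_of_tendsto h3 (Filter.Eventually.of_forall fun s => ?_)
  refine Submodule.sum_mem _ fun l _ => ?_
  have h4 : lp.single 2 l (v l) = v l • unitSeq l := by
    rw [unitSeq, ← lp.single_smul, smul_eq_mul, mul_one]
  rw [h4, map_smul]
  refine Submodule.smul_mem _ _ ?_
  rw [← h1 l]
  exact h2 l

/-- Replaces the chosen range function by the explicit span of the generator fibers, which is all
that is used afterwards. -/
theorem IsFSI.exists_generators {W : Submodule ℂ (L2 k)} (hW : IsFSI W) :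
    ∃ (m : ℕ) (φ : Fin m → L2 k),
      (∀ f, f ∈ W ↔ ∀ᵐ x : Torus k,
        fiber f x ∈ Submodule.span ℂ (Set.range fun i => fiber (φ i) x)) ∧
      ∀ᵐ x : Torus k, fiberDim W x =
        Module.finrank ℂ (Submodule.span ℂ (Set.range fun i => fiber (φ i) x)) := by
  obtain ⟨A, hA, rfl⟩ := hW
  obtain ⟨m, φ, -, rfl⟩ := hA.fin_param
  refine ⟨m, φ, mem_shiftSpan_iff φ, ?_⟩
  have h : ∃ J, IsRangeFunction (shiftSpan (Set.range φ)) J := ⟨_, isRangeFunction_shiftSpan φ⟩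
  have hr : IsRangeFunction (shiftSpan (Set.range φ)) (rangeFunction (shiftSpan (Set.range φ))) := by
    rw [rangeFunction, dif_pos h]
    exact h.choose_spec
  filter_upwards [hr.ae_le (isRangeFunction_shiftSpan φ),
    (isRangeFunction_shiftSpan φ).ae_le hr] with x h1 h2
  rw [fiberDim, le_antisymm h1 h2]

end Range

/-! ### Eigenvalues of frame operators of finite families -/

section Eigenvalues

variable {H : Type} [NormedAddCommGroup H] [InnerProductSpace ℂ H] {n : ℕ}

theorem inner_frameSum_left (v : Fin n → H) (g h : H) :
    ⟪frameSum v g, h⟫_ℂ = ⟪g, frameSum v h⟫_ℂ := by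
  rw [frameSum_apply, frameSum_apply, sum_inner, inner_sum]
  refine Finset.sum_congr rfl fun j _ => ?_
  rw [inner_smul_left, inner_smul_right, inner_conj_symm, mul_comm]

theorem inner_frameSum_self (v : Fin n → H) (g : H) :
    ⟪g, frameSum v g⟫_ℂ = ((∑ j, ‖⟪v j, g⟫_ℂ‖ ^ 2 : ℝ) : ℂ) := by
  rw [frameSum_apply, inner_sum, Complex.ofReal_sum]
  refine Finset.sum_congr rfl fun j _ => ?_
  rw [inner_smul_right, ← inner_conj_symm g (v j), RCLike.mul_conj]
  simp

theorem sum_norm_inner_sq_of_eigenvector {v : Fin n → H} {g : H} {t : ℝ} (hg : ‖g‖ = 1)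
    (h : frameSum v g = (t : ℂ) • g) : ∑ j, ‖⟪v j, g⟫_ℂ‖ ^ 2 = t := by
  have h1 := inner_frameSum_self v g
  rw [h, inner_smul_right, inner_self_eq_norm_sq_to_K, hg, RCLike.ofReal_one, one_pow,
    mul_one] at h1
  exact (Complex.ofReal_injective h1).symm

theorem frameSum_mem_span (v : Fin n → H) (g : H) :
    frameSum v g ∈ Submodule.span ℂ (Set.range v) := by
  rw [frameSum_apply]
  exact Submodule.sum_mem _ fun i _ => Submodule.smul_mem _ _ (Submodule.subset_span ⟨i, rfl⟩)

theorem mem_eigenspace_frameSum {v : Fin n → H} {t : ℂ} {g : H} :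
    g ∈ Module.End.eigenspace ((frameSum v : H →L[ℂ] H) : H →ₗ[ℂ] H) t ↔
      frameSum v g = t • g := Module.End.mem_eigenspace_iff

theorem mem_span_of_frameSum_eq_smul {v : Fin n → H} {t : ℂ} (ht : t ≠ 0) {g : H}
    (h : frameSum v g = t • g) : g ∈ Submodule.span ℂ (Set.range v) := by
  rw [← inv_smul_smul₀ ht g, ← h]
  exact Submodule.smul_mem _ _ (frameSum_mem_span v g)

/-- The vectors of an orthogonal family are eigenvectors of its frame operator, and the squares of
their norms are its eigenvalues. -/
theorem isEigenvalueSequence_frameSum {x : Fin n → H}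
    (hx : Pairwise fun i j => ⟪x i, x j⟫_ℂ = 0) {μ : ℕ → ℝ≥0} (hμ : Antitone μ)
    (hnorm : ∀ i : Fin n, ‖x i‖ ^ 2 = μ i) (h0 : ∀ j, n ≤ j → μ j = 0) :
    IsEigenvalueSequence (frameSum x) μ := by
  refine ⟨hμ, fun t ht => ?_⟩
  have htc : ((t : ℝ) : ℂ) ≠ 0 := by exact_mod_cast ht.ne'
  have hself : ∀ i, ⟪x i, x i⟫_ℂ = ((μ i : ℝ) : ℂ) := by
    intro i
    rw [inner_self_eq_norm_sq_to_K, ← hnorm]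
    simp
  have hin : ∀ i g, ⟪x i, frameSum x g⟫_ℂ = ((μ i : ℝ) : ℂ) * ⟪x i, g⟫_ℂ := by
    intro i g
    rw [frameSum_apply, inner_sum, Finset.sum_eq_single i]
    · rw [inner_smul_right, hself, mul_comm]
    · intro j _ hj
      rw [inner_smul_right, hx hj.symm, mul_zero]
    · simp
  -- For t > 0 an eigenvector is a combination of the x i, and its coefficient at x i vanishes
  -- unless μ i = t.
  have heig : Module.End.eigenspace ((frameSum x : H →L[ℂ] H) : H →ₗ[ℂ] H) ((t : ℝ) : ℂ) =
      Submodule.span ℂ (Set.range fun i : {i : Fin n // μ i = t} => x i) := by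
    refine le_antisymm (fun g hg => ?_) (Submodule.span_le.2 ?_)
    · rw [mem_eigenspace_frameSum] at hg
      rw [← inv_smul_smul₀ htc g, ← hg, frameSum_apply]
      refine Submodule.smul_mem _ _ (Submodule.sum_mem _ fun i _ => ?_)
      by_cases hi : μ i = t
      · exact Submodule.smul_mem _ _ (Submodule.subset_span ⟨⟨i, hi⟩, rfl⟩)
      · have h1 := hin i g
        rw [hg, inner_smul_right] at h1
        have h2 : ((t : ℝ) : ℂ) - ((μ i : ℝ) : ℂ) ≠ 0 := by
          rw [sub_ne_zero]
          exact_mod_cast Ne.symm hi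
        have h3 : ⟪x i, g⟫_ℂ = 0 :=
          (mul_eq_zero.1 (by rw [sub_mul, h1, sub_self])).resolve_left h2
        rw [h3, zero_smul]
        exact Submodule.zero_mem _
    · rintro _ ⟨⟨i, hi⟩, rfl⟩
      rw [SetLike.mem_coe, mem_eigenspace_frameSum, frameSum_apply, Finset.sum_eq_single i]
      · rw [hself, hi]
      · intro j _ hj
        rw [hx hj, zero_smul]
      · simp
  have hli : LinearIndependent ℂ fun i : {i : Fin n // μ i = t} => x i := by
    refine linearIndependent_of_ne_zero_of_inner_eq_zero (fun i hi => ?_) fun i j hij => ?_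
    · have := hnorm i.1
      rw [hi, i.2, norm_zero, zero_pow two_ne_zero] at this
      exact ht.ne (by exact_mod_cast this)
    · exact hx fun h => hij (Subtype.ext h)
  rw [heig, rank_span hli, Cardinal.mk_range_eq _ hli.injective, Set.encard, ← ENat.card]
  refine ENat.card_congr ⟨fun j => ⟨⟨j.1, ?_⟩, j.2⟩, fun i => ⟨i.1, i.2⟩, fun j => rfl, fun i => rfl⟩
  by_contra hc
  have := j.2
  rw [Set.mem_ofPred_eq, h0 _ (not_lt.1 hc)] at this
  exact ht.ne this

theorem exists_eigenvectorBasis_frameSum (v : Fin n → H) :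
    ∃ (d : ℕ) (b : OrthonormalBasis (Fin d) ℂ (Submodule.span ℂ (Set.range v))) (t : Fin d → ℝ),
      ∀ i, frameSum v (b i : H) = (t i : ℂ) • (b i : H) := by
  let T : Submodule.span ℂ (Set.range v) →ₗ[ℂ] Submodule.span ℂ (Set.range v) :=
    LinearMap.restrict ((frameSum v : H →L[ℂ] H) : H →ₗ[ℂ] H) fun x _ => frameSum_mem_span v x
  have hT : T.IsSymmetric := fun x y => inner_frameSum_left v x y
  refine ⟨_, hT.eigenvectorBasis rfl, hT.eigenvalues rfl, fun i => ?_⟩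
  exact congr_arg Subtype.val (hT.apply_eigenvectorBasis rfl i)

/-- On the finite-dimensional span of v the operator has an eigenbasis with nonnegative eigenvalues;
a basis vector contributes nothing to the image of g, either because its eigenvalue is 0 or because
it is orthogonal to g. -/
theorem frameSum_eq_zero_of_orthogonal_eigenvectors {v : Fin n → H} {g : H}
    (hg : ∀ t : ℝ, 0 < t → ∀ h, frameSum v h = (t : ℂ) • h → ⟪h, g⟫_ℂ = 0) :
    frameSum v g = 0 := by
  obtain ⟨d, b, t, hb⟩ := exists_eigenvectorBasis_frameSum v
  have hb0 : ∀ i, ⟪(b i : H), frameSum v g⟫_ℂ = 0 := by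
    intro i
    rw [← inner_frameSum_left, hb, inner_smul_left]
    have hn : ‖(b i : H)‖ = 1 := b.orthonormal.1 i
    have hnn : 0 ≤ t i := by
      rw [← sum_norm_inner_sq_of_eigenvector hn (hb i)]
      positivity
    rcases hnn.eq_or_lt with h0 | hpos
    · rw [← h0]; simp
    · rw [hg _ hpos _ (hb i), mul_zero]
  have h1 := b.sum_repr ⟨frameSum v g, frameSum_mem_span v g⟩
  have h2 : ∀ i, b.repr ⟨frameSum v g, frameSum_mem_span v g⟩ i = 0 := fun i => by
    rw [b.repr_apply_apply, Submodule.coe_inner]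
    exact hb0 i
  simp only [h2, zero_smul, Finset.sum_const_zero] at h1
  exact (congr_arg Subtype.val h1).symm

/-- `IsEigenvalueSequence` only counts multiplicities of positive values; this recovers eigenvectors
enumerated in the order of μ. -/
theorem exists_orthonormal_of_isEigenvalueSequence {v : Fin n → H} {μ : ℕ → ℝ≥0}
    (h : IsEigenvalueSequence (frameSum v) μ) :
    ∃ (m : ℕ) (u : Fin m → H), Orthonormal ℂ u ∧ (∀ i : Fin m, 0 < μ i) ∧ (∀ j, m ≤ j → μ j = 0) ∧
      (∀ i, frameSum v (u i) = ((μ i : ℝ) : ℂ) • u i) ∧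
      ∀ j, v j ∈ Submodule.span ℂ (Set.range u) := by
  obtain ⟨hanti, hcount⟩ := h
  set K := Submodule.span ℂ (Set.range v) with hK
  have hE : ∀ t : ℝ≥0, 0 < t → ∃ w : ℕ → H,
      (∀ j, μ j = t → frameSum v (w j) = ((t : ℝ) : ℂ) • w j) ∧
      (∀ i j, μ i = t → μ j = t → ⟪w i, w j⟫_ℂ = if i = j then 1 else 0) ∧
      ∀ g, frameSum v g = ((t : ℝ) : ℂ) • g → g ∈ Submodule.span ℂ (w '' {j | μ j = t}) := by
    intro t ht
    have htc : ((t : ℝ) : ℂ) ≠ 0 := by exact_mod_cast ht.ne'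
    set E := Module.End.eigenspace ((frameSum v : H →L[ℂ] H) : H →ₗ[ℂ] H) ((t : ℝ) : ℂ) with hEdef
    have hEK : E ≤ K := fun g hg =>
      mem_span_of_frameSum_eq_smul htc (mem_eigenspace_frameSum.1 hg)
    have hfin : FiniteDimensional ℂ E := Submodule.finiteDimensional_of_le hEK
    have hc := hcount t ht
    rw [← Module.finrank_eq_rank, Cardinal.toENat_nat] at hc
    have hSfin : {j | μ j = t}.Finite := Set.finite_of_encard_eq_coe hc
    have : Finite {j | μ j = t} := hSfin
    have hcard : Nat.card {j | μ j = t} = Module.finrank ℂ E := by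
      rw [Nat.card_coe_set_eq, Set.ncard, hc, ENat.toNat_natCast]
    let b := stdOrthonormalBasis ℂ E
    let σ : {j | μ j = t} ≃ Fin (Module.finrank ℂ E) := Finite.equivFinOfCardEq hcard
    classical
    refine ⟨fun j => if hj : μ j = t then (b (σ ⟨j, hj⟩) : H) else 0, ?_, ?_, ?_⟩
    · intro j hj
      simp only [dif_pos hj]
      exact mem_eigenspace_frameSum.1 (b (σ ⟨j, hj⟩)).2
    · intro i j hi hj
      simp only [dif_pos hi, dif_pos hj]
      have := orthonormal_iff_ite.1 b.orthonormal (σ ⟨i, hi⟩) (σ ⟨j, hj⟩)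
      rw [Submodule.coe_inner] at this
      rw [this]
      simp
    · intro g hg
      have h1 := b.sum_repr ⟨g, mem_eigenspace_frameSum.2 hg⟩
      have h2 : _ = g := congr_arg (Subtype.val : E → H) h1
      rw [← h2, Submodule.coe_sum]
      refine Submodule.sum_mem _ fun i _ => ?_
      rw [Submodule.coe_smul]
      refine Submodule.smul_mem _ _ (Submodule.subset_span ⟨(σ.symm i).1, (σ.symm i).2, ?_⟩)
      have h3 : μ (σ.symm i).1 = t := (σ.symm i).2
      simp only [dif_pos h3]
      simp
  choose! w hw1 hw2 hw3 using hE
  -- Each index j selects its own vector in the basis of the eigenspace for μ j; different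
  -- eigenspaces are orthogonal by symmetry.
  set u : ℕ → H := fun j => w (μ j) j with hu
  have hu1 : ∀ j, 0 < μ j → frameSum v (u j) = ((μ j : ℝ) : ℂ) • u j :=
    fun j hj => hw1 (μ j) hj j rfl
  have hu2 : ∀ i j, 0 < μ i → 0 < μ j → ⟪u i, u j⟫_ℂ = if i = j then 1 else 0 := by
    intro i j hi hj
    by_cases hij : μ i = μ j
    · have := hw2 (μ i) hi i j rfl hij.symm
      simp only [hu]
      rw [← hij]
      exact this
    · rw [if_neg fun h => hij (by rw [h])]
      have h1 := inner_frameSum_left v (u i) (u j)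
      rw [hu1 i hi, hu1 j hj, inner_smul_left, inner_smul_right, Complex.conj_ofReal] at h1
      have h2 : ((μ i : ℝ) : ℂ) - ((μ j : ℝ) : ℂ) ≠ 0 := by
        rw [sub_ne_zero]
        exact_mod_cast hij
      exact (mul_eq_zero.1 (by rw [sub_mul, h1, sub_self])).resolve_left h2
  have huK : ∀ j, 0 < μ j → u j ∈ K := fun j hj =>
    mem_span_of_frameSum_eq_smul (by exact_mod_cast hj.ne') (hu1 j hj)
  have hPfin : {j | 0 < μ j}.Finite := by
    have hon : Orthonormal ℂ fun j : {j | 0 < μ j} => u j := by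
      classical
      rw [orthonormal_iff_ite]
      intro i j
      rw [hu2 i j i.2 j.2]
      simp [Subtype.ext_iff]
    have hli : LinearIndependent ℂ fun j : {j | 0 < μ j} => (⟨u j, huK j j.2⟩ : K) :=
      LinearIndependent.of_comp K.subtype hon.linearIndependent
    exact hli.finite
  obtain ⟨m, hm⟩ : ∃ m : ℕ, ∀ j, 0 < μ j ↔ j < m := by
    obtain ⟨N, hN⟩ := hPfin.bddAbove
    have hex : ∃ j, μ j = 0 := ⟨N + 1, by
      by_contra hc
      have := hN (show 0 < μ (N + 1) from pos_iff_ne_zero.2 hc)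
      omega⟩
    classical
    refine ⟨Nat.find hex, fun j => ⟨fun hj => ?_, fun hj => ?_⟩⟩
    · by_contra hc
      have := hanti (not_lt.1 hc)
      rw [Nat.find_spec hex] at this
      exact absurd hj (not_lt.2 this)
    · exact pos_iff_ne_zero.2 (Nat.find_min hex hj)
  have hm' : ∀ i : Fin m, 0 < μ i := fun i => (hm i).2 i.2
  refine ⟨m, fun i => u i, ?_, hm', fun j hj => ?_, fun i => hu1 i (hm' i), ?_⟩
  · rw [orthonormal_iff_ite]
    intro i j
    rw [hu2 i j (hm' i) (hm' j)]
    simp [Fin.ext_iff]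
  · by_contra hc
    exact absurd ((hm j).1 (pos_iff_ne_zero.2 hc)) (not_lt.2 hj)
  · set U := Submodule.span ℂ (Set.range fun i : Fin m => u i) with hU
    have hEU : ∀ (t : ℝ≥0) (g : H), 0 < t → frameSum v g = ((t : ℝ) : ℂ) • g → g ∈ U := by
      intro t g ht hg
      refine Submodule.span_mono ?_ (hw3 t ht g hg)
      rintro _ ⟨j, rfl, rfl⟩
      exact ⟨⟨j, (hm j).1 ht⟩, rfl⟩
    have hzero : ∀ g ∈ Uᗮ, frameSum v g = 0 := fun g hg =>
      frameSum_eq_zero_of_orthogonal_eigenvectors fun t ht h hh =>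
        (Submodule.mem_orthogonal _ _).1 hg _ (hEU ⟨t, ht.le⟩ h ht hh)
    -- If g is orthogonal to U, then ∑_j |⟨v j, g⟩|² = ⟨g, S g⟩ = 0, so every v j is orthogonal to
    -- g.
    intro j
    rw [← Submodule.orthogonal_orthogonal U, Submodule.mem_orthogonal']
    intro g hg
    have h1 := inner_frameSum_self v g
    rw [hzero g hg, inner_zero_right, eq_comm, Complex.ofReal_eq_zero,
      Finset.sum_eq_zero_iff_of_nonneg fun _ _ => by positivity] at h1
    simpa using h1 j (Finset.mem_univ j)

/-- Total weight at most r, with weights at most 1, is best spent on the first r entries: compare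
every μ i with the threshold μ r. -/
theorem sum_mul_le_sum_range {μ : ℕ → ℝ} (hμ : Antitone μ) (hμ0 : ∀ j, 0 ≤ μ j) {m r : ℕ}
    {c : Fin m → ℝ} (hc0 : ∀ i, 0 ≤ c i) (hc1 : ∀ i, c i ≤ 1) (hc : ∑ i, c i ≤ r) :
    ∑ i, c i * μ i ≤ ∑ i ∈ Finset.range r, μ i := by
  have h1 : ∀ i : Fin m, c i * μ i ≤ c i * μ r + if (i : ℕ) < r then μ i - μ r else 0 := by
    intro i
    split_ifs with hi
    · nlinarith [hc1 i, hμ hi.le]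
    · nlinarith [hc0 i, hμ (not_lt.1 hi)]
  have h2 : ∑ i : Fin m, (if (i : ℕ) < r then μ i - μ r else 0) ≤
      ∑ i ∈ Finset.range r, (μ i - μ r) := by
    rw [Fin.sum_univ_eq_sum_range (fun i => if i < r then μ i - μ r else 0) m,
      ← Finset.sum_filter]
    refine Finset.sum_le_sum_of_subset_of_nonneg ?_ fun i hi _ => ?_
    · intro i hi
      exact Finset.mem_range.2 (Finset.mem_filter.1 hi).2
    · exact sub_nonneg.2 (hμ (Finset.mem_range.1 hi).le)
  calc ∑ i, c i * μ i ≤ ∑ i : Fin m, (c i * μ r + if (i : ℕ) < r then μ i - μ r else 0) :=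
        Finset.sum_le_sum fun i _ => h1 i
    _ ≤ r * μ r + ∑ i ∈ Finset.range r, (μ i - μ r) := by
        rw [Finset.sum_add_distrib, ← Finset.sum_mul]
        exact add_le_add (mul_le_mul_of_nonneg_right hc (hμ0 r)) h2
    _ = ∑ i ∈ Finset.range r, μ i := by
        rw [Finset.sum_sub_distrib, Finset.sum_const, Finset.card_range, nsmul_eq_mul]
        ring

theorem norm_sq_eq_sum_of_mem_span {m : ℕ} {u : Fin m → H} (hu : Orthonormal ℂ u) {g : H}
    (hg : g ∈ Submodule.span ℂ (Set.range u)) : ‖g‖ ^ 2 = ∑ i, ‖⟪u i, g⟫_ℂ‖ ^ 2 := by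
  have h1 := frameSum_eq_starProjection (fun i j hij => hu.2 hij) (fun i _ => hu.1 i) g
  rw [Submodule.starProjection_eq_self_iff.2 hg] at h1
  have h2 := inner_frameSum_self u g
  rw [← h1, inner_self_eq_norm_sq_to_K] at h2
  refine Complex.ofReal_injective (Eq.trans ?_ h2)
  rw [Complex.ofReal_pow]
  rfl

theorem sum_norm_sq_le_of_isEigenvalueSequence {v : Fin n → H} {μ : ℕ → ℝ≥0}
    (h : IsEigenvalueSequence (frameSum v) μ) (I : Finset (Fin n)) :
    ∑ j ∈ I, ‖v j‖ ^ 2 ≤ ∑ i ∈ Finset.range I.card, (μ i : ℝ) := by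
  obtain ⟨m, u, hu, hpos, -, heig, hspan⟩ := exists_orthonormal_of_isEigenvalueSequence h
  have hpos' : ∀ i : Fin m, (0 : ℝ) < μ i := fun i => by exact_mod_cast hpos i
  have hcol : ∀ i, ∑ j, ‖⟪u i, v j⟫_ℂ‖ ^ 2 = μ i := by
    intro i
    simp only [norm_inner_symm (u i)]
    exact sum_norm_inner_sq_of_eigenvector (hu.1 i) (heig i)
  have hrow : ∀ j, ∑ i, ‖⟪u i, v j⟫_ℂ‖ ^ 2 / μ i ≤ 1 := by
    intro j
    set s := ∑ i, ‖⟪u i, v j⟫_ℂ‖ ^ 2 / μ i with hs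
    have hs0 : 0 ≤ s := Finset.sum_nonneg fun i _ => by positivity
    -- With S the frame operator, z is its pseudoinverse applied to v j. Then s = ⟨z, v j⟩ = ⟨z, S
    -- z⟩ = ∑_i |⟨v i, z⟩|² ≥ s², whence s ≤ 1.
    set z := ∑ i, (⟪u i, v j⟫_ℂ / ((μ i : ℝ) : ℂ)) • u i with hz
    have hne : ∀ i : Fin m, ((μ i : ℝ) : ℂ) ≠ 0 := fun i => by exact_mod_cast (hpos i).ne'
    have hz1 : ⟪z, v j⟫_ℂ = (s : ℂ) := by
      rw [hz, sum_inner, hs, Complex.ofReal_sum]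
      refine Finset.sum_congr rfl fun i _ => ?_
      rw [inner_smul_left, map_div₀, Complex.conj_ofReal, div_mul_eq_mul_div, RCLike.conj_mul]
      simp
    have hAz : frameSum v z = ∑ i, ⟪u i, v j⟫_ℂ • u i := by
      rw [hz, map_sum]
      refine Finset.sum_congr rfl fun i _ => ?_
      rw [map_smul, heig, smul_smul, div_mul_cancel₀ _ (hne i)]
    have hz2 : ⟪z, frameSum v z⟫_ℂ = (s : ℂ) := by
      rw [← hz1, hAz, hz, sum_inner, sum_inner]
      refine Finset.sum_congr rfl fun i _ => ?_
      rw [inner_smul_left, inner_smul_left, hu.inner_right_fintype]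
    rw [inner_frameSum_self] at hz2
    have h1 : ‖⟪v j, z⟫_ℂ‖ ^ 2 ≤ s := by
      rw [← Complex.ofReal_injective hz2]
      exact Finset.single_le_sum (f := fun j => ‖⟪v j, z⟫_ℂ‖ ^ 2) (fun _ _ => by positivity)
        (Finset.mem_univ j)
    rw [norm_inner_symm, hz1, Complex.norm_real, Real.norm_of_nonneg hs0] at h1
    nlinarith
  have key := sum_mul_le_sum_range (μ := fun j => (μ j : ℝ)) (m := m) (r := I.card)
    (c := fun i => (∑ j ∈ I, ‖⟪u i, v j⟫_ℂ‖ ^ 2) / μ i) (fun i j hij => by exact_mod_cast h.1 hij)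
    (fun j => NNReal.coe_nonneg _) (fun i => by positivity) (fun i => ?_) ?_
  · refine le_trans (le_of_eq ?_) key
    have h1 : ∀ i : Fin m, (∑ j ∈ I, ‖⟪u i, v j⟫_ℂ‖ ^ 2) / μ i * μ i =
        ∑ j ∈ I, ‖⟪u i, v j⟫_ℂ‖ ^ 2 := fun i => div_mul_cancel₀ _ (hpos' i).ne'
    simp only [h1]
    rw [Finset.sum_comm]
    exact Finset.sum_congr rfl fun j _ => norm_sq_eq_sum_of_mem_span hu (hspan j)
  · rw [div_le_one (hpos' i), ← hcol i]
    exact Finset.sum_le_sum_of_subset_of_nonneg (Finset.subset_univ I) fun _ _ _ => by positivity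
  · simp only [Finset.sum_div]
    rw [Finset.sum_comm]
    refine (Finset.sum_le_sum fun j _ => hrow j).trans ?_
    simp

/-- The rank and the trace of the frame operator of a finite family, in terms of the
eigenvalues. -/
theorem eq_zero_and_sum_of_isEigenvalueSequence {v : Fin n → H} {μ : ℕ → ℝ≥0}
    (h : IsEigenvalueSequence (frameSum v) μ) {D : Submodule ℂ H} [FiniteDimensional ℂ D]
    (hD : ∀ j, v j ∈ D) :
    (∀ j, min (Module.finrank ℂ D) n ≤ j → μ j = 0) ∧
      ∑ j, ‖v j‖ ^ 2 = ∑ i ∈ Finset.range (Module.finrank ℂ D), (μ i : ℝ) := by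
  obtain ⟨m, u, hu, hpos, hzero, heig, hspan⟩ := exists_orthonormal_of_isEigenvalueSequence h
  have huK : ∀ i, u i ∈ Submodule.span ℂ (Set.range v) := fun i =>
    mem_span_of_frameSum_eq_smul (by exact_mod_cast (hpos i).ne') (heig i)
  have hli : LinearIndependent ℂ fun i => (⟨u i, huK i⟩ : Submodule.span ℂ (Set.range v)) :=
    LinearIndependent.of_comp (Submodule.span ℂ (Set.range v)).subtype hu.linearIndependent
  have h1 : m ≤ Module.finrank ℂ (Submodule.span ℂ (Set.range v)) := by
    simpa using hli.fintype_card_le_finrank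
  have h2 : Module.finrank ℂ (Submodule.span ℂ (Set.range v)) ≤ n := by
    exact (finrank_range_le_card (R := ℂ) v).trans_eq (Fintype.card_fin n)
  have h3 : Module.finrank ℂ (Submodule.span ℂ (Set.range v)) ≤ Module.finrank ℂ D :=
    Submodule.finrank_mono (Submodule.span_le.2 (by rintro _ ⟨j, rfl⟩; exact hD j))
  refine ⟨fun j hj => hzero j ?_, ?_⟩
  · exact (le_min (h1.trans h3) (h1.trans h2)).trans hj
  · have hcol : ∀ i, ∑ j, ‖⟪u i, v j⟫_ℂ‖ ^ 2 = μ i := by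
      intro i
      simp only [norm_inner_symm (u i)]
      exact sum_norm_inner_sq_of_eigenvector (hu.1 i) (heig i)
    have h4 : ∑ j, ‖v j‖ ^ 2 = ∑ i : Fin m, (μ i : ℝ) := by
      simp only [norm_sq_eq_sum_of_mem_span hu (hspan _), ← hcol]
      exact Finset.sum_comm
    rw [h4, Fin.sum_univ_eq_sum_range (fun i => (μ i : ℝ)) m]
    refine Finset.sum_subset (Finset.range_mono (h1.trans h3)) fun i _ hi => ?_
    rw [hzero i (not_lt.1 fun h => hi (Finset.mem_range.2 h)), NNReal.coe_zero]

theorem le_norm_of_isEigenvalueSequence {v : Fin n → H} {μ : ℕ → ℝ≥0}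
    (h : IsEigenvalueSequence (frameSum v) μ) (j : ℕ) : (μ j : ℝ) ≤ ∑ i, ‖v i‖ ^ 2 := by
  obtain ⟨m, u, hu, hpos, hzero, heig, -⟩ := exists_orthonormal_of_isEigenvalueSequence h
  rcases lt_or_ge j m with hj | hj
  · have h1 := (frameSum v).le_opNorm (u ⟨j, hj⟩)
    rw [heig, norm_smul, hu.1, Complex.norm_real, mul_one, mul_one,
      Real.norm_of_nonneg (NNReal.coe_nonneg _)] at h1
    exact h1.trans (norm_frameSum_le v)
  · rw [hzero j hj]
    positivity

end Eigenvalues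

/-! ### Majorization -/

section Majorization

theorem decreasing_eq_self {m : ℕ} {b : Fin m → ℝ} (hb : Antitone b) : decreasing b = b := by
  have : Tuple.sort (fun i => -b i) = Equiv.refl _ :=
    Tuple.sort_eq_refl_iff_monotone.2 fun i j hij => neg_le_neg (hb hij)
  rw [decreasing, this]
  rfl

theorem sum_filter_lt_eq_sum_range {m r : ℕ} (hr : r ≤ m) (b : ℕ → ℝ) :
    ∑ i ∈ Finset.univ.filter (fun i : Fin m => (i : ℕ) < r), b i = ∑ i ∈ Finset.range r, b i := by
  rw [Finset.sum_filter, Fin.sum_univ_eq_sum_range (fun i => if i < r then b i else 0) m,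
    ← Finset.sum_filter]
  congr 1
  ext i
  simp only [Finset.mem_filter, Finset.mem_range]
  omega

theorem isMajorizedBy_of_sum_le {n m : ℕ} {a : Fin n → ℝ} {b : ℕ → ℝ} (hb : Antitone b)
    (h : ∀ I : Finset (Fin n), ∑ j ∈ I, a j ≤ ∑ i ∈ Finset.range I.card, b i)
    (hsum : ∑ j, a j = ∑ i ∈ Finset.range m, b i) :
    IsMajorizedBy a (fun i : Fin m => b i) := by
  refine ⟨fun r _ hr => ?_, ?_⟩
  · rw [decreasing_eq_self fun i j hij => hb hij,
      sum_filter_lt_eq_sum_range (hr.trans (min_le_right n m)) b]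
    have hcard : (Finset.univ.filter fun i : Fin n => (i : ℕ) < r).card = r := by
      rw [Finset.card_eq_sum_ones, Finset.sum_filter,
        Fin.sum_univ_eq_sum_range (fun i => if i < r then 1 else 0) n, ← Finset.sum_filter,
        ← Finset.card_eq_sum_ones]
      have : (Finset.range n).filter (fun i => i < r) = Finset.range r := by
        ext i
        simp only [Finset.mem_filter, Finset.mem_range]
        have := hr.trans (min_le_left n m)
        omega
      rw [this, Finset.card_range]
    -- The r largest entries of a are its entries on an r-element index set, to which the hypothesis
    -- applies.
    have := h ((Finset.univ.filter fun i : Fin n => (i : ℕ) < r).map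
      (Tuple.sort fun i => -a i).toEmbedding)
    rw [Finset.sum_map, Finset.card_map, hcard] at this
    exact this
  · rw [hsum, Fin.sum_univ_eq_sum_range b m]

end Majorization

/-! ### A measurable Schur–Horn theorem -/

section SchurHorn

/-- Replace the entries at `p` and `p + 1` of a sequence by the single entry `s`. -/
def collapse {M : Type*} (f : ℕ → M) (s : M) (p i : ℕ) : M :=
  if i < p then f i else if i = p then s else f (i + 1)

theorem map_collapse {M M' : Type*} (g : M → M') (f : ℕ → M) (s : M) (p i : ℕ) :
    g (collapse f s p i) = collapse (fun i => g (f i)) (g s) p i := by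
  unfold collapse
  split_ifs <;> rfl

theorem sum_collapse_of_le {M : Type*} [AddCommMonoid M] (f : ℕ → M) (s : M) {p r : ℕ}
    (h : r ≤ p) : ∑ i ∈ Finset.range r, collapse f s p i = ∑ i ∈ Finset.range r, f i := by
  refine Finset.sum_congr rfl fun i hi => ?_
  rw [collapse, if_pos ((Finset.mem_range.1 hi).trans_le h)]

/-- Used both for the numbers l and for the vectors ⟨x i, g⟩ x i of the frame sums. -/
theorem sum_collapse {M : Type*} [AddCommMonoid M] (f : ℕ → M) (s : M) {p r : ℕ} (h : p < r) :
    ∑ i ∈ Finset.range r, collapse f s p i + (f p + f (p + 1)) =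
      ∑ i ∈ Finset.range (r + 1), f i + s := by
  induction r, h using Nat.le_induction with
  | base =>
    rw [Finset.sum_range_succ, sum_collapse_of_le f s le_rfl, Finset.sum_range_succ f,
      Finset.sum_range_succ f]
    simp only [collapse, lt_irrefl, if_false, if_true]
    abel
  | succ r hr ih =>
    rw [Finset.sum_range_succ, add_right_comm, ih, Finset.sum_range_succ f (r + 1)]
    have h1 : ¬ r < p := by omega
    have h2 : r ≠ p := by omega
    simp only [collapse, if_neg h1, if_neg h2]
    abel

theorem le_of_step {N : ℕ} {l : ℕ → ℝ} (h : ∀ i, i + 1 < N → l (i + 1) ≤ l i) {i j : ℕ}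
    (hij : i ≤ j) (hj : j < N) : l j ≤ l i := by
  induction j, hij using Nat.le_induction with
  | base => exact le_rfl
  | succ j _ ih => exact (h j hj).trans (ih (by omega))

/-- The first `N` entries of `a` and `l` are non-increasing, the former are majorized by the
latter, and the vectors `x 0, …, x (N - 1)` are orthogonal with squared norms `l`. -/
structure IsSchurHornData {H : Type*} [NormedAddCommGroup H] [InnerProductSpace ℂ H] (N : ℕ)
    (a l : ℕ → ℝ) (x : ℕ → H) : Prop where
  anti_left : ∀ i, i + 1 < N → a (i + 1) ≤ a i
  anti_right : ∀ i, i + 1 < N → l (i + 1) ≤ l i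
  sum_le : ∀ r, r ≤ N → ∑ i ∈ Finset.range r, a i ≤ ∑ i ∈ Finset.range r, l i
  sum_eq : ∑ i ∈ Finset.range N, a i = ∑ i ∈ Finset.range N, l i
  inner_eq : ∀ i j, i < N → j < N → i ≠ j → ⟪x i, x j⟫_ℂ = 0
  norm_eq : ∀ i, i < N → ‖x i‖ ^ 2 = l i

namespace IsSchurHornData

variable {H : Type*} [NormedAddCommGroup H] [InnerProductSpace ℂ H] {N : ℕ}
  {a l : ℕ → ℝ} {x : ℕ → H}

/-- If no consecutive pair of l enclosed a 0, all of l would lie strictly above a 0, hence above all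
of a, contradicting equality of the sums. -/
theorem exists_pair (h : IsSchurHornData (N + 1) a l x) (hN : 0 < N) :
    ∃ p < N, l (p + 1) ≤ a 0 ∧ a 0 ≤ l p := by
  by_contra! hc
  have h0 : a 0 ≤ l 0 := by simpa using h.sum_le 1 (by omega)
  have h1 : ∀ q, q ≤ N → a 0 ≤ l q := by
    intro q
    induction q with
    | zero => exact fun _ => h0
    | succ q ih =>
      intro hq
      by_contra hlt
      exact absurd (ih (by omega)) (not_le.2 (hc q (by omega) (not_le.1 hlt).le))
  have h2 : a 0 < l N := by
    obtain ⟨q, rfl⟩ : ∃ q, N = q + 1 := ⟨N - 1, by omega⟩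
    by_contra hlt
    exact absurd (h1 q (by omega)) (not_le.2 (hc q (by omega) (not_lt.1 hlt)))
  have h3 : ∑ i ∈ Finset.range (N + 1), a i < ∑ i ∈ Finset.range (N + 1), l i := by
    refine Finset.sum_lt_sum_of_nonempty (by simp) fun i hi => ?_
    have hi' := Finset.mem_range.1 hi
    calc a i ≤ a 0 := le_of_step h.anti_left (Nat.zero_le i) hi'
      _ < l N := h2
      _ ≤ l i := le_of_step h.anti_right (by omega) (by omega)
  exact h3.ne h.sum_eq

/-- The new entry lies between l (p + 1) and l p, so the order survives. Partial sums up to p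
compare termwise through a 0 ≤ l p; longer ones are the old inequality for r + 1 with a 0 removed.
Nothing is asked of w relative to the vector set aside. -/
theorem collapse (h : IsSchurHornData (N + 1) a l x) {p : ℕ} (hp : p < N)
    (h1 : l (p + 1) ≤ a 0) (h2 : a 0 ≤ l p) {w : H}
    (hw : ‖w‖ ^ 2 = l p + l (p + 1) - a 0)
    (hw0 : ∀ i, i < N + 1 → i ≠ p → i ≠ p + 1 → ⟪w, x i⟫_ℂ = 0) :
    IsSchurHornData N (fun j => a (j + 1)) (collapse l (l p + l (p + 1) - a 0) p)
      (ShiftGenerated.collapse x w p) := by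
  have hsum : ∀ r, p < r → ∑ i ∈ Finset.range r,
      ShiftGenerated.collapse l (l p + l (p + 1) - a 0) p i =
        ∑ i ∈ Finset.range (r + 1), l i - a 0 := by
    intro r hr
    have := sum_collapse l (l p + l (p + 1) - a 0) hr
    linarith
  refine ⟨fun i hi => h.anti_left (i + 1) (by omega), fun i hi => ?_, fun r hr => ?_, ?_, ?_, ?_⟩
  · have e1 := h.anti_right i (by omega)
    have e2 := h.anti_right (i + 1) (by omega)
    unfold ShiftGenerated.collapse
    rcases lt_trichotomy i p with hip | hip | hip
    · rw [if_pos hip]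
      rcases (Nat.succ_le_of_lt hip).lt_or_eq with hip' | hip'
      · rwa [if_pos hip']
      · rw [if_neg (by omega), if_pos hip']
        have e3 : i + 1 = p := hip'
        rw [e3] at e1
        linarith
    · subst hip
      rw [if_neg (by omega), if_neg (by omega), if_neg (by omega), if_pos rfl]
      linarith
    · rw [if_neg (by omega), if_neg (by omega), if_neg (by omega), if_neg (by omega)]
      exact e2
  · rcases le_or_gt r p with hrp | hrp
    · rw [sum_collapse_of_le _ _ hrp]
      refine Finset.sum_le_sum fun i hi => ?_
      have hi' := Finset.mem_range.1 hi
      calc a (i + 1) ≤ a 0 := le_of_step h.anti_left (Nat.zero_le _) (by omega)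
        _ ≤ l p := h2
        _ ≤ l i := le_of_step h.anti_right (by omega) (by omega)
    · rw [hsum r hrp]
      have := h.sum_le (r + 1) (by omega)
      rw [Finset.sum_range_succ' a] at this
      linarith
  · rw [hsum N hp, ← h.sum_eq, Finset.sum_range_succ' a]
    ring
  · intro i j hi hj hij
    have hw0' : ∀ i, i < N + 1 → i ≠ p → i ≠ p + 1 → ⟪x i, w⟫_ℂ = 0 := fun i h1 h2 h3 => by
      rw [← inner_conj_symm, hw0 i h1 h2 h3, map_zero]
    unfold ShiftGenerated.collapse
    split_ifs
    all_goals first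
      | exact h.inner_eq _ _ (by omega) (by omega) (by omega)
      | exact hw0 _ (by omega) (by omega) (by omega)
      | exact hw0' _ (by omega) (by omega) (by omega)
      | omega
  · intro i hi
    unfold ShiftGenerated.collapse
    split_ifs
    · exact h.norm_eq i (by omega)
    · exact hw
    · exact h.norm_eq _ (by omega)

end IsSchurHornData

variable {k : ℕ} {Ω : Type*} [MeasurableSpace Ω]

/-- Measurable fields given on the members of a finite measurable cover can be glued. -/
theorem exists_glue {ι J : Type*} (s : Finset ι) (A : ι → Set Ω) (hA : ∀ c, MeasurableSet (A c))
    (v : ι → J → Ω → SeqSpace k) (hv : ∀ c j, CoordMeasurable (v c j)) :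
    ∃ v' : J → Ω → SeqSpace k, (∀ j, CoordMeasurable (v' j)) ∧
      ∀ ω, (∃ c ∈ s, ω ∈ A c) → ∃ c ∈ s, ω ∈ A c ∧ ∀ j, v' j ω = v c j ω := by
  classical
  induction s using Finset.induction_on with
  | empty => exact ⟨fun _ _ => 0, fun _ => CoordMeasurable.zero, by simp⟩
  | insert c s hc ih =>
    obtain ⟨v', hv', h⟩ := ih
    refine ⟨fun j ω => if ω ∈ A c then v c j ω else v' j ω,
      fun j => CoordMeasurable.ite (hA c) (hv c j) (hv' j), fun ω hω => ?_⟩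
    by_cases hωc : ω ∈ A c
    · exact ⟨c, Finset.mem_insert_self c s, hωc, fun j => if_pos hωc⟩
    · obtain ⟨d, hd, hωd⟩ := hω
      rw [Finset.mem_insert] at hd
      rcases hd with rfl | hd
      · exact absurd hωd hωc
      · obtain ⟨e, he, hωe, hve⟩ := h ω ⟨d, hd, hωd⟩
        refine ⟨e, Finset.mem_insert_of_mem he, hωe, fun j => ?_⟩
        rw [← hve]
        exact if_neg hωc

/-- A rotation of two vectors does not change the sum of their rank one operators. -/
theorem rotation_identity {H : Type*} [NormedAddCommGroup H] [InnerProductSpace ℂ H] {c s : ℝ}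
    (hcs : c ^ 2 + s ^ 2 = 1) (x y g : H) :
    ⟪(c : ℂ) • x + (s : ℂ) • y, g⟫_ℂ • ((c : ℂ) • x + (s : ℂ) • y) +
      ⟪(-s : ℂ) • x + (c : ℂ) • y, g⟫_ℂ • ((-s : ℂ) • x + (c : ℂ) • y) =
      ⟪x, g⟫_ℂ • x + ⟪y, g⟫_ℂ • y := by
  have h : (c : ℂ) ^ 2 + (s : ℂ) ^ 2 = 1 := by exact_mod_cast hcs
  simp only [inner_add_left, inner_smul_left, Complex.conj_ofReal, map_neg]
  rw [← one_smul ℂ (⟪x, g⟫_ℂ • x + ⟪y, g⟫_ℂ • y), ← h]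
  module

theorem norm_rotation_sq {H : Type*} [NormedAddCommGroup H] [InnerProductSpace ℂ H] (c s : ℝ)
    {x y : H} (hxy : ⟪x, y⟫_ℂ = 0) :
    ‖(c : ℂ) • x + (s : ℂ) • y‖ ^ 2 = c ^ 2 * ‖x‖ ^ 2 + s ^ 2 * ‖y‖ ^ 2 := by
  have h : ⟪(c : ℂ) • x, (s : ℂ) • y⟫_ℂ = 0 := by
    rw [inner_smul_left, inner_smul_right, hxy, mul_zero, mul_zero]
  have := norm_add_sq_eq_norm_sq_add_norm_sq_of_inner_eq_zero _ _ h
  simp only [norm_smul, Complex.norm_real] at this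
  rw [pow_two, this]
  have e1 := Real.norm_eq_abs c ▸ sq_abs c
  have e2 := Real.norm_eq_abs s ▸ sq_abs s
  rw [← e1, ← e2]
  ring

/-- **Schur–Horn theorem**, measurable version: an orthogonal family with squared norms `l`
can be replaced by a family with prescribed squared norms `a`, majorized by `l`, without changing
the frame operator. -/
theorem exists_schurHorn (N : ℕ) (a l : ℕ → Ω → ℝ) (x : ℕ → Ω → SeqSpace k)
    (ha : ∀ j, Measurable (a j)) (hl : ∀ j, Measurable (l j)) (hx : ∀ j, CoordMeasurable (x j)) :
    ∃ v : ℕ → Ω → SeqSpace k, (∀ j, CoordMeasurable (v j)) ∧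
      ∀ ω, IsSchurHornData N (fun j => a j ω) (fun j => l j ω) (fun j => x j ω) →
        (∀ j, j < N → ‖v j ω‖ ^ 2 = a j ω) ∧
        ∀ g, ∑ j ∈ Finset.range N, ⟪v j ω, g⟫_ℂ • v j ω =
          ∑ j ∈ Finset.range N, ⟪x j ω, g⟫_ℂ • x j ω := by
  induction N generalizing a l x with
  | zero => exact ⟨x, hx, fun ω _ => ⟨fun j hj => by omega, fun g => rfl⟩⟩
  | succ N ih =>
    rcases Nat.eq_zero_or_pos N with rfl | hN
    · refine ⟨x, hx, fun ω h => ⟨fun j hj => ?_, fun g => rfl⟩⟩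
      have h1 := h.sum_eq
      simp only [zero_add, Finset.sum_range_one] at h1
      obtain rfl : j = 0 := by omega
      rw [h1]
      exact h.norm_eq 0 (by omega)
    -- The position p depends on ω. The construction is made for each fixed p everywhere on Ω,
    -- asserted only where p is admissible, and glued afterwards.
    have key : ∀ p : ℕ, ∃ v : ℕ → Ω → SeqSpace k, (∀ j, CoordMeasurable (v j)) ∧
        ∀ ω, p < N → l (p + 1) ω ≤ a 0 ω → a 0 ω ≤ l p ω →
        IsSchurHornData (N + 1) (fun j => a j ω) (fun j => l j ω) (fun j => x j ω) →
        (∀ j, j < N + 1 → ‖v j ω‖ ^ 2 = a j ω) ∧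
        ∀ g, ∑ j ∈ Finset.range (N + 1), ⟪v j ω, g⟫_ℂ • v j ω =
          ∑ j ∈ Finset.range (N + 1), ⟪x j ω, g⟫_ℂ • x j ω := by
      intro p
      -- The solution of t l_p + (1 - t) l_{p+1} = a_0, with t = cos² of the rotation angle. If l_p
      -- = l_{p+1} the quotient is 0, which also solves it.
      set t : Ω → ℝ := fun ω => (a 0 ω - l (p + 1) ω) / (l p ω - l (p + 1) ω) with ht
      have htm : Measurable t := ((ha 0).sub (hl _)).div ((hl _).sub (hl _))
      set c : Ω → ℝ := fun ω => Real.sqrt (t ω) with hc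
      set s : Ω → ℝ := fun ω => Real.sqrt (1 - t ω) with hs
      have hcm : Measurable fun ω => (c ω : ℂ) := Complex.measurable_ofReal.comp htm.sqrt
      have hsm : Measurable fun ω => (s ω : ℂ) :=
        Complex.measurable_ofReal.comp (measurable_const.sub htm).sqrt
      set v0 : Ω → SeqSpace k := fun ω => (c ω : ℂ) • x p ω + (s ω : ℂ) • x (p + 1) ω with hv0
      set w : Ω → SeqSpace k := fun ω => (-s ω : ℂ) • x p ω + (c ω : ℂ) • x (p + 1) ω with hw
      have hv0m : CoordMeasurable v0 :=
        (CoordMeasurable.smul hcm (hx _)).add (CoordMeasurable.smul hsm (hx _))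
      have hwm : CoordMeasurable w :=
        (CoordMeasurable.smul hsm.neg (hx _)).add (CoordMeasurable.smul hcm (hx _))
      obtain ⟨v, hvm, hv⟩ := ih (fun j => a (j + 1))
        (collapse l (fun ω => l p ω + l (p + 1) ω - a 0 ω) p) (collapse x w p)
        (fun j => ha _) (fun j => by
          unfold collapse
          split_ifs
          · exact hl _
          · exact ((hl _).add (hl _)).sub (ha 0)
          · exact hl _) (fun j => by
          unfold collapse
          split_ifs
          · exact hx _
          · exact hwm
          · exact hx _)
      refine ⟨fun j => Nat.casesOn j v0 v, fun j => ?_, fun ω hp h1 h2 h => ?_⟩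
      · cases j
        · exact hv0m
        · exact hvm _
      have ht0 : 0 ≤ t ω := div_nonneg (sub_nonneg.2 h1) (sub_nonneg.2 (h1.trans h2))
      have ht1 : t ω ≤ 1 := div_le_one_of_le₀ (by linarith) (sub_nonneg.2 (h1.trans h2))
      have hc2 : c ω ^ 2 = t ω := Real.sq_sqrt ht0
      have hs2 : s ω ^ 2 = 1 - t ω := Real.sq_sqrt (sub_nonneg.2 ht1)
      have htl : t ω * l p ω + (1 - t ω) * l (p + 1) ω = a 0 ω := by
        rcases eq_or_ne (l p ω - l (p + 1) ω) 0 with h0 | h0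
        · have : t ω = 0 := by simp only [ht, h0, div_zero]
          rw [this]
          linarith
        · have : t ω * (l p ω - l (p + 1) ω) = a 0 ω - l (p + 1) ω := div_mul_cancel₀ _ h0
          linarith
      have hxp : ⟪x p ω, x (p + 1) ω⟫_ℂ = 0 := h.inner_eq _ _ (by omega) (by omega) (by omega)
      have hv0n : ‖v0 ω‖ ^ 2 = a 0 ω := by
        have e1 := h.norm_eq p (by omega)
        have e2 := h.norm_eq (p + 1) (by omega)
        simp only [hv0]
        rw [norm_rotation_sq _ _ hxp, e1, e2, hc2, hs2, htl]
      have hwn : ‖w ω‖ ^ 2 = l p ω + l (p + 1) ω - a 0 ω := by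
        have e1 := h.norm_eq p (by omega)
        have e2 := h.norm_eq (p + 1) (by omega)
        simp only [hw]
        rw [← Complex.ofReal_neg, norm_rotation_sq _ _ hxp, e1, e2, neg_sq, hc2, hs2, ← htl]
        ring
      have hw0 : ∀ i, i < N + 1 → i ≠ p → i ≠ p + 1 → ⟪w ω, x i ω⟫_ℂ = 0 := by
        intro i hi h3 h4
        simp only [hw]
        have e1 : ⟪x p ω, x i ω⟫_ℂ = 0 := h.inner_eq _ _ (by omega) hi h3.symm
        have e2 : ⟪x (p + 1) ω, x i ω⟫_ℂ = 0 := h.inner_eq _ _ (by omega) hi h4.symm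
        rw [inner_add_left, inner_smul_left, inner_smul_left, e1, e2, mul_zero, mul_zero, add_zero]
      have hdata := h.collapse hp h1 h2 hwn hw0
      have hv' := hv ω (by
        convert! hdata using 2
        · rename_i i
          exact map_collapse (fun f : Ω → ℝ => f ω) l _ p i
        · rename_i i
          exact map_collapse (fun f : Ω → SeqSpace k => f ω) x _ p i)
      constructor
      · intro j hj
        cases j with
        | zero => exact hv0n
        | succ j => exact hv'.1 j (by omega)
      · intro g
        rw [Finset.sum_range_succ']
        refine (congr_arg (· + ⟪v0 ω, g⟫_ℂ • v0 ω) (hv'.2 g)).trans ?_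
        have e1 : ∀ i, ⟪collapse x w p i ω, g⟫_ℂ • collapse x w p i ω =
            collapse (fun i => ⟪x i ω, g⟫_ℂ • x i ω) (⟪w ω, g⟫_ℂ • w ω) p i := fun i =>
          map_collapse (fun f : Ω → SeqSpace k => ⟪f ω, g⟫_ℂ • f ω) x w p i
        simp only [e1]
        have e2 := sum_collapse (fun i => ⟪x i ω, g⟫_ℂ • x i ω) (⟪w ω, g⟫_ℂ • w ω) hp
        rw [← rotation_identity (c := c ω) (s := s ω) (by rw [hc2, hs2]; ring)] at e2
        rw [← add_assoc] at e2
        exact add_right_cancel e2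
    choose v hvm hv using key
    -- By `exists_pair` the sets of admissible p cover every relevant ω; they may overlap.
    obtain ⟨v', hv'm, hv'⟩ := exists_glue (Finset.range N)
      (fun p => {ω | l (p + 1) ω ≤ a 0 ω} ∩ {ω | a 0 ω ≤ l p ω})
      (fun p => (measurableSet_le (hl _) (ha 0)).inter (measurableSet_le (ha 0) (hl _))) v hvm
    refine ⟨v', hv'm, fun ω h => ?_⟩
    obtain ⟨p, hp, h1, h2⟩ := h.exists_pair hN
    obtain ⟨q, hq, ⟨h3, h4⟩, h5⟩ := hv' ω ⟨p, Finset.mem_range.2 hp, h1, h2⟩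
    simp only [h5]
    exact hv q ω (Finset.mem_range.1 hq) h3 h4 h

end SchurHorn

/-! ### Measurable fields with prescribed norms and eigenvalues -/

section Fields

/-- Any sorting permutation gives the same rearrangement, so one permutation can serve a whole
measurable piece. -/
theorem decreasing_eq_comp {n : ℕ} {a : Fin n → ℝ} {σ : Equiv.Perm (Fin n)}
    (h : Antitone (a ∘ σ)) : decreasing a = a ∘ σ := by
  have h1 : (fun i => -a i) ∘ σ = (fun i => -a i) ∘ Tuple.sort (fun i => -a i) :=
    Tuple.comp_sort_eq_comp_iff_monotone.2 (fun i j hij => neg_le_neg (h hij))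
  ext i
  have := congr_fun h1 i
  simp only [Function.comp_apply, neg_inj] at this
  exact this.symm

/-- The entries of a finite tuple, followed by zeros. -/
def extendZero {n : ℕ} {M : Type*} [Zero M] (f : Fin n → M) (j : ℕ) : M :=
  if h : j < n then f ⟨j, h⟩ else 0

theorem extendZero_coe {n : ℕ} {M : Type*} [Zero M] (f : Fin n → M) (j : Fin n) :
    extendZero f j = f j := dif_pos j.2

theorem extendZero_of_lt {n : ℕ} {M : Type*} [Zero M] (f : Fin n → M) {j : ℕ} (h : j < n) :
    extendZero f j = f ⟨j, h⟩ := dif_pos h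

theorem isSchurHornData_of_isMajorizedBy {H : Type*} [NormedAddCommGroup H]
    [InnerProductSpace ℂ H] {n d : ℕ} {a : Fin n → ℝ} (ha : ∀ j, 0 ≤ a j) {l : ℕ → ℝ}
    (hl : Antitone l) (hl0 : ∀ j, min d n ≤ j → l j = 0)
    (hm : IsMajorizedBy a (fun j : Fin d => l j)) {σ : Equiv.Perm (Fin n)}
    (hσ : Antitone (a ∘ σ)) {u : Fin d → H} (hu : Orthonormal ℂ u) :
    IsSchurHornData n (extendZero (a ∘ σ)) l
      (fun j => (Real.sqrt (l j) : ℂ) • extendZero u j) := by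
  have hl_nonneg : ∀ j, 0 ≤ l j := fun j => by
    rw [← hl0 (max j (min d n)) (le_max_right _ _)]
    exact hl (le_max_left _ _)
  have hsum : ∀ r, min d n ≤ r →
      ∑ i ∈ Finset.range r, l i = ∑ i ∈ Finset.range (min d n), l i := fun r hr =>
    (Finset.sum_subset (Finset.range_mono hr) fun i _ hi =>
      hl0 i (not_lt.1 fun h => hi (Finset.mem_range.2 h))).symm
  have htot : ∑ j, a j = ∑ i ∈ Finset.range (min d n), l i := by
    rw [hm.2, Fin.sum_univ_eq_sum_range l d, hsum d (min_le_left _ _)]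
  have hatot : ∑ i ∈ Finset.range n, extendZero (a ∘ σ) i = ∑ j, a j := by
    rw [← Fin.sum_univ_eq_sum_range (extendZero (a ∘ σ)) n]
    simp only [extendZero_coe]
    exact Equiv.sum_comp σ a
  have ha0 : ∀ i, 0 ≤ extendZero (a ∘ σ) i := fun i => by
    unfold extendZero
    split_ifs
    · exact ha _
    · exact le_rfl
  refine ⟨fun i hi => ?_, fun i _ => hl (Nat.le_succ i), fun r hr => ?_, ?_, ?_, ?_⟩
  · rw [extendZero_of_lt _ hi, extendZero_of_lt _ (by omega : i < n)]
    exact hσ (Fin.mk_le_mk.2 (Nat.le_succ i))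
  · rcases le_or_gt r (min n d) with hrm | hrm
    · rcases Nat.eq_zero_or_pos r with rfl | hr0
      · simp
      · have h1 := hm.1 r hr0 hrm
        rw [decreasing_eq_comp hσ, decreasing_eq_self fun i j hij => hl hij,
          sum_filter_lt_eq_sum_range (hrm.trans (min_le_right n d)) l] at h1
        refine le_trans (le_of_eq ?_) h1
        rw [← sum_filter_lt_eq_sum_range hr (extendZero (a ∘ σ))]
        simp only [extendZero_coe]
    -- Majorization gives partial sums only up to min n d. Beyond it l has already reached its
    -- total, which bounds every partial sum of the nonnegative a.
    · rw [hsum r (by rw [min_comm]; exact hrm.le), ← htot, ← hatot]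
      exact Finset.sum_le_sum_of_subset_of_nonneg (Finset.range_mono hr) fun i _ _ => ha0 i
  · rw [hatot, htot, hsum n (min_le_right _ _)]
  · intro i j _ _ hij
    rw [inner_smul_left, inner_smul_right]
    unfold extendZero
    split_ifs with h1 h2
    · rw [hu.2 (fun h => hij (Fin.mk.inj_iff.1 h)), mul_zero, mul_zero]
    all_goals simp
  · intro i _
    rw [norm_smul, mul_pow, Complex.norm_real, Real.norm_of_nonneg (Real.sqrt_nonneg _),
      Real.sq_sqrt (hl_nonneg i)]
    rcases lt_or_ge i d with hi | hi
    · rw [extendZero_of_lt _ hi, hu.1, one_pow, mul_one]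
    · rw [hl0 i ((min_le_left _ _).trans hi), zero_mul]

/-- A vector orthogonal to all x is killed by the common operator, so it is orthogonal to every v j.
This keeps the rotated vectors inside the fiber of W. -/
theorem mem_span_of_frameSum_eq {H : Type} [NormedAddCommGroup H] [InnerProductSpace ℂ H]
    {n n' : ℕ} {v : Fin n → H} {x : Fin n' → H} (h : ∀ g, frameSum v g = frameSum x g) (j : Fin n) :
    v j ∈ Submodule.span ℂ (Set.range x) := by
  rw [← Submodule.orthogonal_orthogonal (Submodule.span ℂ (Set.range x)),
    Submodule.mem_orthogonal']
  intro g hg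
  have h0 : frameSum x g = 0 := by
    rw [frameSum_apply]
    refine Finset.sum_eq_zero fun i _ => ?_
    rw [(Submodule.mem_orthogonal _ _).1 hg _ (Submodule.subset_span ⟨i, rfl⟩), zero_smul]
  have h1 := inner_frameSum_self v g
  rw [h, h0, inner_zero_right, eq_comm, Complex.ofReal_eq_zero,
    Finset.sum_eq_zero_iff_of_nonneg fun _ _ => by positivity] at h1
  simpa using h1 j (Finset.mem_univ j)

/-! ### The nonzero Gram–Schmidt vectors as an orthonormal basis -/

section Subfamily

variable {H : Type} [NormedAddCommGroup H] [InnerProductSpace ℂ H] {m : ℕ} {f : Fin m → H}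
  {T : Finset (Fin m)}

theorem orthonormal_gramSchmidtNormed_subfamily
    (hT : ∀ i, InnerProductSpace.gramSchmidtNormed ℂ f i ≠ 0 ↔ i ∈ T) :
    Orthonormal ℂ fun i => InnerProductSpace.gramSchmidtNormed ℂ f (T.orderEmbOfFin rfl i) := by
  refine ⟨fun i => InnerProductSpace.gramSchmidtNormed_unit_length'
    ((hT _).2 (Finset.orderEmbOfFin_mem T rfl i)), fun i j hij => ?_⟩
  exact gramSchmidtNormed_inner_eq_zero f fun h => hij ((T.orderEmbOfFin rfl).injective h)

theorem span_gramSchmidtNormed_subfamily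
    (hT : ∀ i, InnerProductSpace.gramSchmidtNormed ℂ f i ≠ 0 ↔ i ∈ T) :
    Submodule.span ℂ (Set.range fun i =>
      InnerProductSpace.gramSchmidtNormed ℂ f (T.orderEmbOfFin rfl i)) =
      Submodule.span ℂ (Set.range f) := by
  rw [← span_range_gramSchmidtNormed f]
  refine le_antisymm (Submodule.span_mono ?_) (Submodule.span_le.2 ?_)
  · rintro _ ⟨i, rfl⟩
    exact ⟨_, rfl⟩
  · rintro _ ⟨i, rfl⟩
    by_cases h : InnerProductSpace.gramSchmidtNormed ℂ f i = 0
    · rw [h]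
      exact Submodule.zero_mem _
    · have hi : i ∈ Set.range (T.orderEmbOfFin rfl) := by
        rw [Finset.range_orderEmbOfFin]
        exact (hT i).1 h
      obtain ⟨i', rfl⟩ := hi
      exact Submodule.subset_span ⟨i', rfl⟩

theorem finrank_span_eq_card_subfamily
    (hT : ∀ i, InnerProductSpace.gramSchmidtNormed ℂ f i ≠ 0 ↔ i ∈ T) :
    Module.finrank ℂ (Submodule.span ℂ (Set.range f)) = T.card := by
  rw [← span_gramSchmidtNormed_subfamily hT, finrank_span_eq_card
    (orthonormal_gramSchmidtNormed_subfamily hT).linearIndependent, Fintype.card_fin]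

end Subfamily

variable {k m n : ℕ} {Ω : Type*} [MeasurableSpace Ω]

/-- Only finitely many combinatorial cases occur: which Gram–Schmidt vectors are nonzero, and how α
is sorted. In each case the measurable Schur–Horn theorem applies to √λ_i e_i. The dimension is a
variable d so that an almost everywhere equal function can be inserted. -/
theorem exists_fields (φ : Fin m → Ω → SeqSpace k) (hφ : ∀ i, CoordMeasurable (φ i))
    (α : Fin n → Ω → ℝ≥0) (hα : ∀ j, Measurable (α j)) (lam : ℕ → Ω → ℝ≥0)
    (hlam : ∀ j, Measurable (lam j)) :
    ∃ v : Fin n → Ω → SeqSpace k, (∀ j, CoordMeasurable (v j)) ∧ ∀ ω d,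
      d = Module.finrank ℂ (Submodule.span ℂ (Set.range fun i => φ i ω)) →
      Antitone (fun j => lam j ω) → (∀ j, min d n ≤ j → lam j ω = 0) →
      IsMajorizedBy (fun j => (α j ω : ℝ)) (fun j : Fin d => (lam j ω : ℝ)) →
      (∀ j, ‖v j ω‖ ^ 2 = α j ω) ∧
      IsEigenvalueSequence (frameSum fun j => v j ω) (fun j => lam j ω) ∧
      ∀ j, v j ω ∈ Submodule.span ℂ (Set.range fun i => φ i ω) := by
  classical
  set e : Fin m → Ω → SeqSpace k :=
    fun i ω => InnerProductSpace.gramSchmidtNormed ℂ (fun j => φ j ω) i with he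
  have hem : ∀ i, CoordMeasurable (e i) := CoordMeasurable.gramSchmidtNormed hφ
  -- Ties in α let pieces overlap; gluing needs only a cover.
  set A : Finset (Fin m) × Equiv.Perm (Fin n) → Set Ω := fun c =>
    {ω | (∀ i, e i ω ≠ 0 ↔ i ∈ c.1) ∧ Antitone ((fun j => (α j ω : ℝ)) ∘ c.2)} with hA
  have hAm : ∀ c, MeasurableSet (A c) := by
    intro c
    have h1 : ∀ i, MeasurableSet {ω | e i ω ≠ 0 ↔ i ∈ c.1} := by
      intro i
      have h0 : MeasurableSet {ω | e i ω ≠ 0} := by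
        have := (hem i).norm (measurableSet_singleton (0 : ℝ)).compl
        convert! this using 1
        ext ω
        simp
      by_cases hi : i ∈ c.1
      · simpa [hi] using h0
      · have h1 : {ω | e i ω ≠ 0 ↔ i ∈ c.1} = {ω | e i ω ≠ 0}ᶜ := by
          ext ω
          simp [hi]
        rw [h1]
        exact h0.compl
    have h2 : ∀ i j, MeasurableSet {ω | i ≤ j → (α (c.2 j) ω : ℝ) ≤ α (c.2 i) ω} := by
      intro i j
      by_cases hij : i ≤ j
      · simpa [hij] using measurableSet_le (hα (c.2 j)) (hα (c.2 i))
      · simp [hij]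
    have h3 : A c = (⋂ i, {ω | e i ω ≠ 0 ↔ i ∈ c.1}) ∩
        ⋂ i, ⋂ j, {ω | i ≤ j → (α (c.2 j) ω : ℝ) ≤ α (c.2 i) ω} := by
      ext ω
      simp only [hA, Set.mem_ofPred_eq, Set.mem_inter_iff, Set.mem_iInter]
      exact Iff.rfl
    rw [h3]
    exact (MeasurableSet.iInter h1).inter (MeasurableSet.iInter fun i => MeasurableSet.iInter (h2 i))
  have key : ∀ c : Finset (Fin m) × Equiv.Perm (Fin n), ∃ v : Fin n → Ω → SeqSpace k,
      (∀ j, CoordMeasurable (v j)) ∧ ∀ ω ∈ A c,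
      Antitone (fun j => lam j ω) → (∀ j, min c.1.card n ≤ j → lam j ω = 0) →
      IsMajorizedBy (fun j => (α j ω : ℝ)) (fun j : Fin c.1.card => (lam j ω : ℝ)) →
      (∀ j, ‖v j ω‖ ^ 2 = α j ω) ∧
      IsEigenvalueSequence (frameSum fun j => v j ω) (fun j => lam j ω) ∧
      ∀ j, v j ω ∈ Submodule.span ℂ (Set.range fun i => φ i ω) := by
    rintro ⟨T, σ⟩
    have hval : ∀ ω j, extendZero (fun i : Fin T.card => e (T.orderEmbOfFin rfl i)) j ω =
        extendZero (fun i : Fin T.card => e (T.orderEmbOfFin rfl i) ω) j := by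
      intro ω j
      unfold extendZero
      split_ifs <;> rfl
    have hval' : ∀ ω j, extendZero (fun i : Fin n => fun ω => (α (σ i) ω : ℝ)) j ω =
        extendZero ((fun i : Fin n => (α i ω : ℝ)) ∘ σ) j := by
      intro ω j
      unfold extendZero
      split_ifs <;> rfl
    obtain ⟨v, hvm, hv⟩ := exists_schurHorn n
      (extendZero fun i : Fin n => fun ω => (α (σ i) ω : ℝ)) (fun j ω => (lam j ω : ℝ))
      (fun j ω => (Real.sqrt (lam j ω) : ℂ) •
        extendZero (fun i : Fin T.card => e (T.orderEmbOfFin rfl i)) j ω)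
      (fun j => by
        unfold extendZero
        split_ifs
        · exact (hα _).coe_nnreal_real
        · exact measurable_const)
      (fun j => (hlam j).coe_nnreal_real)
      (fun j => by
        refine CoordMeasurable.smul
          (Complex.measurable_ofReal.comp (hlam j).coe_nnreal_real.sqrt) ?_
        unfold extendZero
        split_ifs
        · exact hem _
        · exact CoordMeasurable.zero)
    -- Undoes the sorting; permuting the vectors leaves the frame operator alone.
    refine ⟨fun j => v (σ.symm j), fun j => hvm _, fun ω hω h1 h2 h3 => ?_⟩
    obtain ⟨hT, hσ⟩ := hω
    have hdata := isSchurHornData_of_isMajorizedBy (fun j => NNReal.coe_nonneg (α j ω))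
      (l := fun j => (lam j ω : ℝ)) (fun i j hij => h1 hij)
      (fun j hj => by simp only [h2 j hj, NNReal.coe_zero]) h3 hσ
      (orthonormal_gramSchmidtNormed_subfamily hT)
    obtain ⟨hn, hs⟩ := hv ω (by
      simp only [hval, hval']
      exact hdata)
    set x : ℕ → SeqSpace k := fun j => (Real.sqrt (lam j ω) : ℂ) •
      extendZero (fun i : Fin T.card => e (T.orderEmbOfFin rfl i) ω) j with hx
    have hframe : ∀ g, frameSum (fun j : Fin n => v (σ.symm j) ω) g =
        frameSum (fun j : Fin n => x j) g := by
      intro g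
      rw [frameSum_apply, frameSum_apply,
        Equiv.sum_comp σ.symm (fun j : Fin n => ⟪v j ω, g⟫_ℂ • v j ω),
        Fin.sum_univ_eq_sum_range (fun j => ⟪v j ω, g⟫_ℂ • v j ω) n, hs,
        Fin.sum_univ_eq_sum_range (fun j => ⟪x j, g⟫_ℂ • x j) n]
      simp only [hval, hx]
    refine ⟨fun j => ?_, ?_, fun j => ?_⟩
    · rw [hn _ (σ.symm j).2, hval', extendZero_coe, Function.comp_apply, Equiv.apply_symm_apply]
    -- The eigenvalues are read off from the original orthogonal family, which has the same frame
    -- operator.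
    · rw [ContinuousLinearMap.ext hframe]
      refine isEigenvalueSequence_frameSum (fun i j hij => ?_) h1 (fun i => hdata.norm_eq i i.2)
        (fun j hj => h2 j ((min_le_right _ _).trans hj))
      exact hdata.inner_eq i j i.2 j.2 fun h => hij (Fin.ext h)
    · rw [← span_gramSchmidtNormed_subfamily hT]
      refine Submodule.span_le.2 ?_ (mem_span_of_frameSum_eq hframe j)
      rintro _ ⟨i, rfl⟩
      refine Submodule.smul_mem _ _ ?_
      unfold extendZero
      split_ifs with hi
      · exact Submodule.subset_span ⟨⟨i, hi⟩, rfl⟩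
      · exact Submodule.zero_mem _
  choose v hvm hv using key
  obtain ⟨v', hvm', hv'⟩ := exists_glue Finset.univ A hAm v hvm
  refine ⟨v', hvm', fun ω d hd h1 h2 h3 => ?_⟩
  obtain ⟨c, -, hc, hvc⟩ := hv' ω ⟨(Finset.univ.filter fun i => e i ω ≠ 0,
    Tuple.sort fun j => -(α j ω : ℝ)), Finset.mem_univ _, by simp,
    antitone_decreasing fun j => (α j ω : ℝ)⟩
  have hd' : d = c.1.card := hd.trans (finrank_span_eq_card_subfamily hc.1)
  subst hd'
  simp only [hvc]
  exact hv c ω hc h1 h2 h3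

end Fields

/-! ### The main theorem -/

section Main

variable {k n : ℕ} {W : Submodule ℂ (L2 k)}

theorem eigenvalue_conditions_of_isBessel_translates (hW : IsFSI W)
    {α : Fin n → Torus k → ℝ≥0} {lam : ℕ → Torus k → ℝ≥0}
    {F : Fin n → L2 k} (hF : ∀ j, F j ∈ W) (hB : IsBessel (translates F))
    (hα : ∀ j, ∀ᵐ x : Torus k, ‖fiber (F j) x‖ ^ 2 = (α j x : ℝ))
    (hlam : ∀ᵐ x : Torus k,
      IsEigenvalueSequence (fiberOperator (frameOperator (translates F) hB) x)
        (fun j => lam j x)) :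
    (∃ C : ℝ≥0, ∀ j, ∀ᵐ x : Torus k, lam j x ≤ C) ∧
      (∀ j, ∀ᵐ x : Torus k, lam (j + 1) x ≤ lam j x) ∧
      (∀ᵐ x : Torus k, ∀ j, min (fiberDim W x) n ≤ j → lam j x = 0) ∧
      (∀ᵐ x : Torus k, IsMajorizedBy (fun j : Fin n => (α j x : ℝ))
        (fun j : Fin (fiberDim W x) => (lam j x : ℝ))) := by
  obtain ⟨m, φ, hmem, hdim⟩ := hW.exists_generators
  have hev : ∀ᵐ x : Torus k, IsEigenvalueSequence (frameSum fun j => fiber (F j) x)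
      (fun j => lam j x) := by
    filter_upwards [hlam, fiberOperator_frameOperator_ae hB] with x h1 h2
    rwa [h2] at h1
  have hJ : ∀ᵐ x : Torus k, ∀ j,
      fiber (F j) x ∈ Submodule.span ℂ (Set.range fun i => fiber (φ i) x) :=
    ae_all_iff.2 fun j => (hmem (F j)).1 (hF j)
  obtain ⟨b, hb0, hb⟩ := ae_norm_fiber_sq_le_of_isBessel hB
  refine ⟨⟨(n * b).toNNReal, fun j => ?_⟩, fun j => ?_, ?_, ?_⟩
  · filter_upwards [hev, hb] with x h1 h2
    rw [← NNReal.coe_le_coe, Real.coe_toNNReal _ (by positivity)]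
    refine (le_norm_of_isEigenvalueSequence h1 j).trans
      ((Finset.sum_le_sum fun i _ => h2 i).trans ?_)
    simp
  · exact hev.mono fun x h => h.1 (Nat.le_succ j)
  · filter_upwards [hev, hJ, hdim] with x h1 h2 h3
    rw [h3]
    exact (eq_zero_and_sum_of_isEigenvalueSequence h1 h2).1
  · filter_upwards [hev, hJ, hdim, ae_all_iff.2 hα] with x h1 h2 h3 h4
    simp only [← h4]
    refine isMajorizedBy_of_sum_le (b := fun j => (lam j x : ℝ)) (fun i j hij => h1.1 hij)
      (fun I => sum_norm_sq_le_of_isEigenvalueSequence h1 I) ?_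
    rw [h3]
    exact (eq_zero_and_sum_of_isEigenvalueSequence h1 h2).2

theorem exists_isBessel_translates (hW : IsFSI W) {α : Fin n → Torus k → ℝ≥0}
    (hα : ∀ j, Measurable (α j))
    {lam : ℕ → Torus k → ℝ≥0} (hlam : ∀ j, Measurable (lam j))
    (hC : ∃ C : ℝ≥0, ∀ j, ∀ᵐ x : Torus k, lam j x ≤ C)
    (hanti : ∀ j, ∀ᵐ x : Torus k, lam (j + 1) x ≤ lam j x)
    (hzero : ∀ᵐ x : Torus k, ∀ j, min (fiberDim W x) n ≤ j → lam j x = 0)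
    (hmaj : ∀ᵐ x : Torus k, IsMajorizedBy (fun j : Fin n => (α j x : ℝ))
      (fun j : Fin (fiberDim W x) => (lam j x : ℝ))) :
    ∃ F : Fin n → L2 k, (∀ j, F j ∈ W) ∧ ∃ hB : IsBessel (translates F),
      (∀ j, ∀ᵐ x : Torus k, ‖fiber (F j) x‖ ^ 2 = (α j x : ℝ)) ∧
      ∀ᵐ x : Torus k,
        IsEigenvalueSequence (fiberOperator (frameOperator (translates F) hB) x)
          (fun j => lam j x) := by
  obtain ⟨m, φ, hmem, hdim⟩ := hW.exists_generators
  obtain ⟨C, hC⟩ := hC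
  obtain ⟨v, hvm, hv⟩ := exists_fields (fun i => fiber (φ i))
    (fun i => coordMeasurable_fiber (φ i)) α hα lam hlam
  have hgood : ∀ᵐ x : Torus k, (∀ j, ‖v j x‖ ^ 2 = α j x) ∧
      IsEigenvalueSequence (frameSum fun j => v j x) (fun j => lam j x) ∧
      ∀ j, v j x ∈ Submodule.span ℂ (Set.range fun i => fiber (φ i) x) := by
    filter_upwards [hdim, ae_all_iff.2 hanti, hzero, hmaj] with x h1 h2 h3 h4
    exact hv x _ h1 (antitone_nat_of_succ_le h2) h3 h4
  -- No bound on α is assumed: equality of the totals, with at most n nonzero λ_i ≤ C, forces α_j ≤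
  -- nC, which gives the Bessel property.
  have hbound : ∀ᵐ x : Torus k, ∀ j, ‖v j x‖ ^ 2 ≤ n * C := by
    filter_upwards [hgood, hmaj, hzero, ae_all_iff.2 hC] with x h1 h2 h3 h4 j
    rw [h1.1 j]
    calc (α j x : ℝ) ≤ ∑ i, (α i x : ℝ) :=
          Finset.single_le_sum (f := fun i => (α i x : ℝ)) (fun _ _ => NNReal.coe_nonneg _)
            (Finset.mem_univ j)
      _ = ∑ i ∈ Finset.range (fiberDim W x), (lam i x : ℝ) := by
          rw [h2.2, Fin.sum_univ_eq_sum_range (fun i => (lam i x : ℝ))]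
      _ = ∑ i ∈ Finset.range (min (fiberDim W x) n), (lam i x : ℝ) :=
          (Finset.sum_subset (Finset.range_mono (min_le_left _ _)) fun i _ hi => by
            rw [h3 i (not_lt.1 fun h => hi (Finset.mem_range.2 h)), NNReal.coe_zero]).symm
      _ ≤ ∑ i ∈ Finset.range (min (fiberDim W x) n), (C : ℝ) :=
          Finset.sum_le_sum fun i _ => NNReal.coe_le_coe.2 (h4 i)
      _ ≤ n * C := by
          rw [Finset.sum_const, Finset.card_range, nsmul_eq_mul]
          gcongr
          exact min_le_right _ _
  choose F hF using fun j => exists_fiber_eq_of_bounded (hvm j) (hbound.mono fun x hx => hx j)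
  have hF' := ae_all_iff.2 hF
  have hB : IsBessel (translates F) := isBessel_translates (b := n * C) (by
    filter_upwards [hF', hbound] with x h1 h2 j
    rw [h1 j]
    exact h2 j)
  refine ⟨F, fun j => ?_, hB, fun j => ?_, ?_⟩
  · rw [hmem]
    filter_upwards [hF j, hgood] with x h1 h2
    rw [h1]
    exact h2.2.2 j
  · filter_upwards [hF j, hgood] with x h1 h2
    rw [h1]
    exact h2.1 j
  · filter_upwards [hF', hgood, fiberOperator_frameOperator_ae hB] with x h1 h2 h3
    rw [h3]
    simp only [h1]
    exact h2.2.1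

end Main

end ShiftGenerated

end

theorem theorem3p3 (k n : ℕ) (W : Submodule ℂ (L2 k)) (hW : IsFSI W)
    (α : Fin n → Torus k → ℝ≥0) (hα : ∀ j, Measurable (α j))
    (lam : ℕ → Torus k → ℝ≥0) (hlam : ∀ j, Measurable (lam j)) :
    (∃ F : Fin n → L2 k, (∀ j, F j ∈ W) ∧ ∃ hB : IsBessel (translates F),
        (∀ j, ∀ᵐ x : Torus k, ‖fiber (F j) x‖ ^ 2 = (α j x : ℝ)) ∧
        ∀ᵐ x : Torus k,
          IsEigenvalueSequence (fiberOperator (frameOperator (translates F) hB) x)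
            (fun j => lam j x)) ↔
      (∃ C : ℝ≥0, ∀ j, ∀ᵐ x : Torus k, lam j x ≤ C) ∧
      (∀ j, ∀ᵐ x : Torus k, lam (j + 1) x ≤ lam j x) ∧
      (∀ᵐ x : Torus k, ∀ j, min (fiberDim W x) n ≤ j → lam j x = 0) ∧
      (∀ᵐ x : Torus k, IsMajorizedBy (fun j : Fin n => (α j x : ℝ))
        (fun j : Fin (fiberDim W x) => (lam j x : ℝ))) := by
  constructor
  · rintro ⟨F, hF, hB, hα', hl⟩
    exact eigenvalue_conditions_of_isBessel_translates hW hF hB hα' hl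
  · rintro ⟨hC, hanti, hzero, hmaj⟩
    exact exists_isBessel_translates hW hα hlam hC hanti hzero hmaj
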